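/- Let $n\ge 1$, $C>1$ and $C_1,C_2\in\mathbb R$. There is a constant $K\ge 1$, depending only on $C$, $C_1$, $C_2$ and $n$, such that the following holds. Let $M$ be a smooth $n$-manifold (without boundary, not necessarily compact). A Finsler metric on $M$ is a continuous function $F\colon TM\to[0,\infty)$ that is $C^\infty$ off the zero section, satisfies $F(x,\lambda v)=\lambda F(x,v)$ for $\lambda>0$, vanishes exactly on the zero section, and is such that the Hessian of $F^2(x,\cdot)$ is positive definite at every $v\neq 0$. Its quasireversibility constant is $\sup\{F(x,-v) : (x,v)\in TM,\ F(x,v)=1\}$. Let $\pi\colon HM=(TM\smallsetminus 0)/\mathbb R_{>0}\to M$ be the bundle of tangent directions, and let $A$ be the Hilbert form of $F$, i.e. the $1$-form on $HM$ given by $A_{(x,[v])}(Z)=\frac{d}{d\varepsilon}\big|_{\varepsilon=0}F(x,v+\varepsilon\, d\pi(Z))$. It is a contact form; let $X$ be its Reeb field, $A(X)=1$ and $i_X dA=0$. For $f\in H^1_{loc}(M)$ (i.e. $f$ is in $L^2_{loc}$ with a weak differential $df$ in $L^2_{loc}$), put $L_X(\pi^*f)=df(d\pi(X))$ and define the energy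 $$E^F(f)=\frac{n}{\operatorname{vol}(\mathbb S^{n-1})}\int_{HM}\left|L_X(\pi^*f)\right|^2\,A\wedge dA^{n-1}\in[0,\infty],$$ where $HM$ is oriented by $A\wedge dA^{n-1}$. Let $F$ and $F_0$ be Finsler metrics on $M$ with (finite) quasireversibility constants $C_1$ and $C_2$ respectively, such that $C^{-1}\le F(x,v)/F_0(x,v)\le C$ for all $(x,v)\in TM$ with $v\ne0$. Then for every $f\in H^1_{loc}(M)$, in particular for every $f\in H^1(M)$, $$C^{-K}\,E^{F_0}(f)\le E^F(f)\le C^{K}\,E^{F_0}(f).$$ Hence $C^{-K}\le E^F(f)/E^{F_0}(f)\le C^K$ whenever $0<E^{F_0}(f)<\infty$. -/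

import Mathlib

open Set MeasureTheory
open scoped Manifold ContDiff ENNReal

noncomputable section

namespace Finsler

/-- The model space `ℝⁿ` of an `n`-dimensional manifold, where `n = d + 1 ≥ 1`. -/
abbrev Model (d : ℕ) : Type := EuclideanSpace ℝ (Fin (d + 1))

/-- Smooth Finsler metrics on a manifold `M` of dimension `n = d + 1`. -/
structure FinslerMetric (d : ℕ) (M : Type*) [TopologicalSpace M] [ChartedSpace (Model d) M]
    [IsManifold 𝓘(ℝ, Model d) ∞ M] where
  /-- The function `F : TM → ℝ`. -/
  toFun : TangentBundle 𝓘(ℝ, Model d) M → ℝ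
  continuous_toFun : Continuous toFun
  /-- Smoothness away from the zero section. -/
  smooth : ContMDiffOn 𝓘(ℝ, Model d).tangent 𝓘(ℝ, ℝ) ∞ toFun {p | p.2 ≠ 0}
  /-- Positive homogeneity. -/
  homogeneous : ∀ (x : M) (v : TangentSpace 𝓘(ℝ, Model d) x) (t : ℝ), 0 < t →
    toFun ⟨x, t • v⟩ = t * toFun ⟨x, v⟩
  nonneg : ∀ p, 0 ≤ toFun p
  eq_zero_iff : ∀ (x : M) (v : TangentSpace 𝓘(ℝ, Model d) x), toFun ⟨x, v⟩ = 0 ↔ v = 0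
  /-- Strong convexity: the vertical Hessian of `F²` is positive definite off the zero section. -/
  strongly_convex : ∀ (x : M) (v u : Model d), v ≠ 0 → u ≠ 0 →
    0 < fderiv ℝ (fderiv ℝ (fun w : Model d => toFun ⟨x, w⟩ ^ 2)) v u u

section Exterior

variable {V : Type*} [NormedAddCommGroup V] [NormedSpace ℝ V]

/-- A field of linear forms, seen as a differential `1`-form. -/
def oneForm (A : V → V →L[ℝ] ℝ) : V → V [⋀^Fin 1]→L[ℝ] ℝ :=
  fun p => ContinuousAlternatingMap.ofSubsingleton ℝ V ℝ (0 : Fin 1) (A p)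

/-- The exterior derivative `dA` of the `1`-form `A`. -/
def dOneForm (A : V → V →L[ℝ] ℝ) : V → V [⋀^Fin 2]→L[ℝ] ℝ :=
  extDeriv (oneForm A)

/-- The value of `a ∧ b ∧ ⋯ ∧ b` (with `d` factors `b`) on `2 d + 1` vectors, for a linear form `a`
and an alternating `2`-form `b`:
`(a ∧ bᵈ)(v) = (1! (2!)ᵈ)⁻¹ ∑_σ sign σ · a(v_{σ 0}) · ∏ᵢ b(v_{σ (2i+1)}, v_{σ (2i+2)})`.
The `2 d + 1` slots are named `none` (in the place of `0`), `some (i, false)` (in the place of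
`2 i + 1`) and `some (i, true)` (in the place of `2 i + 2`). -/
def wedgePow {d : ℕ} (a : V →L[ℝ] ℝ) (b : V [⋀^Fin 2]→L[ℝ] ℝ)
    (v : Option (Fin d × Bool) → V) : ℝ :=
  ((2 : ℝ) ^ d)⁻¹ * ∑ σ : Equiv.Perm (Option (Fin d × Bool)),
    ((Equiv.Perm.sign σ : ℤ) : ℝ) * a (v (σ none)) *
      ∏ i : Fin d, b ![v (σ (some (i, false))), v (σ (some (i, true)))]

/-- `X` is a value at `p` of the Reeb field of `A`: `A(X) = 1` and `i_X dA = 0`. -/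
def IsReebAt (A : V → V →L[ℝ] ℝ) (p X : V) : Prop :=
  A p X = 1 ∧ ∀ Z : V, dOneForm A p ![X, Z] = 0

/-- The Reeb field of the `1`-form `A` (which is unique where `A` is a contact form). -/
def reeb (A : V → V →L[ℝ] ℝ) (p : V) : V :=
  Classical.epsilon (IsReebAt A p)

end Exterior

section HomogenizedBundle

/-- Coordinates `(y, w)` on the homogenized bundle `HM = (TM ∖ 0) / ℝ₊`, of dimension
`2 n - 1 = 2 d + 1`: `y` is the coordinate of the base point in a chart of `M`, and `w` is an affine
coordinate on the set of directions. -/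
abbrev HCoord (d : ℕ) : Type := Model d × EuclideanSpace ℝ (Fin d)

/-- For a sign `s = ± 1`, the vector `(s, w₁, …, w_d)`. The directions of these vectors, for
`w ∈ ℝᵈ`, form the open half `{s v₀ > 0}` of the sphere of directions of `ℝⁿ`; the two halves
together miss only the equator `{v₀ = 0}`, which is a null set. -/
def direction {d : ℕ} (s : ℤˣ) (w : EuclideanSpace ℝ (Fin d)) : Model d :=
  WithLp.toLp 2 (Fin.cons ((s : ℤ) : ℝ) (fun i => w i))

/-- The coordinate frame of `HCoord d`, in the order
`∂/∂y₀, ∂/∂y₁, ∂/∂w₀, ∂/∂y₂, ∂/∂w₁, …`. -/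
def coordFrame (d : ℕ) : Option (Fin d × Bool) → HCoord d
  | none => (EuclideanSpace.single 0 1, 0)
  | some (i, false) => (EuclideanSpace.single i.succ 1, 0)
  | some (i, true) => (0, EuclideanSpace.single i 1)

variable {d : ℕ} {M : Type*} [TopologicalSpace M] [ChartedSpace (Model d) M]
  [IsManifold 𝓘(ℝ, Model d) ∞ M]

/-- The Finsler metric read in the coordinates of `TM` induced by a chart `e` of `M`. -/
def FinslerMetric.inChart (F : FinslerMetric d M) (e : OpenPartialHomeomorph M (Model d))
    (y v : Model d) : ℝ :=
  F.toFun (tangentMap 𝓘(ℝ, Model d) 𝓘(ℝ, Model d) e.symm ⟨y, v⟩)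

/-- The Hilbert form `A` of `F`, a `1`-form on `HM`, in the coordinates `(y, w)`:
`A_{(x, ξ)}(Z)` is the derivative of `F(x, ·)` at a representative `v` of `ξ` in the direction
`dπ(Z)`. -/
def FinslerMetric.hilbertForm (F : FinslerMetric d M) (e : OpenPartialHomeomorph M (Model d))
    (s : ℤˣ) (p : HCoord d) : HCoord d →L[ℝ] ℝ :=
  (fderiv ℝ (F.inChart e p.1) (direction s p.2)).comp
    (ContinuousLinearMap.fst ℝ (Model d) (EuclideanSpace ℝ (Fin d)))

/-- The density of the volume form `A ∧ dAⁿ⁻¹` with respect to Lebesgue measure in the coordinates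
`(y, w)`. The absolute value accounts for the orientation of `HM` by `A ∧ dAⁿ⁻¹` itself. -/
def FinslerMetric.contactDensity (F : FinslerMetric d M)
    (e : OpenPartialHomeomorph M (Model d)) (s : ℤˣ) (p : HCoord d) : ℝ :=
  |wedgePow (F.hilbertForm e s p) (dOneForm (F.hilbertForm e s) p) (coordFrame d)|

end HomogenizedBundle

section Sobolev

variable {d : ℕ}

/-- `u` belongs to `L²_loc(U)`. -/
def MemL2Loc {G : Type*} [NormedAddCommGroup G] (U : Set (Model d)) (u : Model d → G) : Prop :=
  ∀ S ⊆ U, IsCompact S → MemLp u 2 (volume.restrict S)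

/-- On the open set `U`, `u ∈ L²_loc` has the weak differential `g ∈ L²_loc`. -/
def HasWeakGradientOn (U : Set (Model d)) (u : Model d → ℝ) (g : Model d → Model d →L[ℝ] ℝ) :
    Prop :=
  MemL2Loc U u ∧ MemL2Loc U g ∧
    ∀ φ : Model d → ℝ, ContDiff ℝ ∞ φ → HasCompactSupport φ → tsupport φ ⊆ U →
      ∀ v : Model d, ∫ y, u y * fderiv ℝ φ y v = - ∫ y, g y v * φ y

variable {M : Type*} [TopologicalSpace M] [ChartedSpace (Model d) M]

/-- A field of covectors on `M` (with no regularity) read in a chart `e`. -/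
def covectorInChart (η : ∀ x : M, TangentSpace 𝓘(ℝ, Model d) x →L[ℝ] ℝ)
    (e : OpenPartialHomeomorph M (Model d)) (y : Model d) : Model d →L[ℝ] ℝ :=
  (η (e.symm y)).comp (mfderiv 𝓘(ℝ, Model d) 𝓘(ℝ, Model d) e.symm y)

/-- `η` is a weak differential of `f`, both being of class `L²_loc`. -/
def IsWeakDifferential (f : M → ℝ) (η : ∀ x : M, TangentSpace 𝓘(ℝ, Model d) x →L[ℝ] ℝ) :
    Prop :=
  ∀ e ∈ atlas (Model d) M, HasWeakGradientOn e.target (f ∘ e.symm) (covectorInChart η e)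

variable (d) in
/-- `f` belongs to `H¹_loc(M)`: it is in `L²_loc` with a weak differential in `L²_loc`. -/
def MemH1Loc (f : M → ℝ) : Prop :=
  ∃ η : ∀ x : M, TangentSpace 𝓘(ℝ, Model d) x →L[ℝ] ℝ, IsWeakDifferential f η

open Classical in
variable (d) in
/-- The weak differential `df` of `f ∈ H¹_loc(M)`, which is unique up to null sets. -/
def weakDifferential (f : M → ℝ) (x : M) : TangentSpace 𝓘(ℝ, Model d) x →L[ℝ] ℝ :=
  if h : MemH1Loc d f then h.choose x else 0

end Sobolev

section Energy

variable {d : ℕ} {M : Type*} [TopologicalSpace M] [ChartedSpace (Model d) M]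
  [IsManifold 𝓘(ℝ, Model d) ∞ M]

/-- The function `L_X(π^* f) = df(dπ(X))` on `HM`, in coordinates, where `X` is the Reeb field of the
Hilbert form. -/
def FinslerMetric.lieReeb (F : FinslerMetric d M) (f : M → ℝ)
    (e : OpenPartialHomeomorph M (Model d)) (s : ℤˣ) (p : HCoord d) : ℝ :=
  covectorInChart (weakDifferential d f) e p.1 (reeb (F.hilbertForm e s) p).1

variable (d M) in
/-- A Borel piece of `M` contained in the domain of a chart. -/
structure ChartPiece where
  chart : OpenPartialHomeomorph M (Model d)
  chart_mem : chart ∈ atlas (Model d) M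
  carrier : Set M
  measurable : MeasurableSet[borel M] carrier
  subset_source : carrier ⊆ chart.source

/-- `∫ |L_X(π^* f)|² A ∧ dAⁿ⁻¹` over the part of `HM` above a piece of `M`, in coordinates. -/
def FinslerMetric.energyOn (F : FinslerMetric d M) (f : M → ℝ) (P : ChartPiece d M) : ℝ≥0∞ :=
  ∑ s : ℤˣ, ∫⁻ p in (P.chart '' P.carrier) ×ˢ (univ : Set (EuclideanSpace ℝ (Fin d))),
    ENNReal.ofReal (F.lieReeb f P.chart s p ^ 2 * F.contactDensity P.chart s p)

/-- The energy `E^F(f) = n / vol(Sⁿ⁻¹) ∫_{HM} |L_X(π^* f)|² A ∧ dAⁿ⁻¹ ∈ [0, ∞]`. The integrand is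
nonnegative, and its integral over `HM` is the supremum, over the finite families of disjoint
Borel pieces of `M` lying in charts, of the integrals above these pieces. -/
def FinslerMetric.energy (F : FinslerMetric d M) (f : M → ℝ) : ℝ≥0∞ :=
  ENNReal.ofReal
      (((d + 1 : ℕ) : ℝ) / (volume : Measure (Model d)).toSphere.real univ) *
    ⨆ (S : Finset (ChartPiece d M)) (_ : (S : Set (ChartPiece d M)).PairwiseDisjoint
      ChartPiece.carrier), ∑ P ∈ S, F.energyOn f P

/-- `C₁` is the quasireversibility constant of `F`:
`C₁ = sup {F(x, -v) | (x, v) ∈ TM, F(x, v) = 1}`, the supremum being finite. -/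
def FinslerMetric.IsQuasireversibilityConstant (F : FinslerMetric d M) (C₁ : ℝ) : Prop :=
  IsLUB {r : ℝ | ∃ (x : M) (v : TangentSpace 𝓘(ℝ, Model d) x),
    F.toFun ⟨x, v⟩ = 1 ∧ r = F.toFun ⟨x, -v⟩} C₁

/-- `F` and `F₀` are `C`-bi-Lipschitz: `C⁻¹ ≤ F / F₀ ≤ C` on nonzero tangent vectors. -/
def FinslerMetric.BiLipschitz (F F₀ : FinslerMetric d M) (C : ℝ) : Prop :=
  ∀ (x : M) (v : TangentSpace 𝓘(ℝ, Model d) x), v ≠ 0 →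
    C⁻¹ ≤ F.toFun ⟨x, v⟩ / F₀.toFun ⟨x, v⟩ ∧ F.toFun ⟨x, v⟩ / F₀.toFun ⟨x, v⟩ ≤ C

end Energy

end Finsler

end

/-! The comparison is made fibre by fibre. Fix a base point and write φ for `F` on its tangent space
ℝⁿ, n = d + 1. The Hilbert form at the direction of `v` is the momentum p = dφ_v, which lies on the
unit sphere of the dual norm φ*. In coordinates `(y, w)` only the mixed values of `dA` enter `A ∧
dAⁿ⁻¹`, and they are derivatives of p along the fibre. The contact density is therefore a universal
multiple of |det(p, ∂p/∂w)|, the angular Jacobian of the polar coordinates (r, w) ↦ r p(w) on the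
dual space (`wedgePow_coordFrame`, `contactDensity_eq`). The Reeb field projects to v/φ(v)
(`reeb_fst`). Thus, up to factors common to both metrics, the energy is the integral over the base
of the fibre energy of L = df: the integral over the dual unit ball B* of L(v_ξ)², where v_ξ is the
φ-unit vector at which ξ attains its dual norm.

The fibre energy is comparable to φ*(L)² vol(B*). From above, |L(v)| ≤ (1 + |c|) φ*(L) φ(v) if φ(-v)
≤ c φ(v) (`fibreEnergy_le`). From below, if ξ stays in a small translate of a multiple of B* centred
at L/(2φ*(L)), then v_ξ nearly maximizes L and L(v_ξ) ≥ φ*(L)/2 (`le_fibreEnergy`). A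
`C`-bi-Lipschitz change of norm alters φ*(L) by at most a factor `C` and vol(B*) by at most `C`ⁿ
(`fibreEnergy_le_compConst_mul`).

The pointwise bound integrates over chart pieces (`energy_le`). Since `C > 1`, the resulting
constant is absorbed into a power of `C`. -/

noncomputable section

namespace Finsler

/-! ### The top form `a ∧ bᵈ` on the coordinate frame as a determinant -/

section WedgeAlgebra

/-- Whether a slot of the coordinate frame is a fibre direction `∂/∂wₖ`. -/
def isFibreSlot {d : ℕ} : Option (Fin d × Bool) → Bool
  | some (_, true) => true
  | _ => false

/-- The signed sum over permutations that defines `a ∧ bᵈ`, for arrays `a` and `b` of values. -/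
def wedgeSum {d : ℕ} (a : Option (Fin d × Bool) → ℝ)
    (b : Option (Fin d × Bool) → Option (Fin d × Bool) → ℝ) : ℝ :=
  ∑ σ : Equiv.Perm (Option (Fin d × Bool)),
    ((Equiv.Perm.sign σ : ℤ) : ℝ) * a (σ none) *
      ∏ i : Fin d, b (σ (some (i, false))) (σ (some (i, true)))

lemma sum_slots {d : ℕ} (g : Option (Fin d × Bool) → ℕ) :
    ∑ x, g x = g none + ∑ i : Fin d, (g (some (i, false)) + g (some (i, true))) := by
  rw [Fintype.sum_option, Fintype.sum_prod_type]
  congr 1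
  refine Finset.sum_congr rfl fun i _ => ?_
  rw [Fintype.sum_bool, add_comm]

/-- If a permutation of the slots neither moves a fibre slot to `none` nor pairs two fibre slots,
then every pair contains a fibre slot. -/
lemma isFibreSlot_or_of_perm {d : ℕ} (σ : Equiv.Perm (Option (Fin d × Bool)))
    (h0 : isFibreSlot (σ none) = false)
    (h : ∀ i, ¬ (isFibreSlot (σ (some (i, false))) = true ∧
      isFibreSlot (σ (some (i, true))) = true)) (i : Fin d) :
    isFibreSlot (σ (some (i, false))) = true ∨ isFibreSlot (σ (some (i, true))) = true := by
  set g : Option (Fin d × Bool) → ℕ := fun x => (isFibreSlot x).toNat with hg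
  -- Counting: there are exactly `d` fibre slots, none of them lands in `none`, and each of the `d`
  -- pairs holds at most one. So each pair holds exactly one.
  have h1 : ∑ x, g (σ x) = d := by
    rw [Equiv.sum_comp σ g, sum_slots]
    simp [hg, isFibreSlot]
  rw [sum_slots (fun x => g (σ x))] at h1
  have hle : ∀ i ∈ (Finset.univ : Finset (Fin d)),
      g (σ (some (i, false))) + g (σ (some (i, true))) ≤ 1 := by
    intro i _
    have := h i
    simp only [hg]
    cases h1 : isFibreSlot (σ (some (i, false))) <;>
      cases h2 : isFibreSlot (σ (some (i, true))) <;> simp_all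
  have hsum : ∑ i : Fin d, (g (σ (some (i, false))) + g (σ (some (i, true)))) =
      ∑ _i : Fin d, 1 := by
    have : g (σ none) = 0 := by simp [hg, h0]
    rw [this, zero_add] at h1
    simpa using h1
  have := (Finset.sum_eq_sum_iff_of_le hle).1 hsum i (Finset.mem_univ i)
  simp only [hg] at this
  cases h1 : isFibreSlot (σ (some (i, false))) <;>
    cases h2 : isFibreSlot (σ (some (i, true))) <;> simp_all

/-- The values of `b` on pairs of base slots do not contribute to `a ∧ bᵈ`. -/
lemma wedgeSum_congr {d : ℕ} {a a' : Option (Fin d × Bool) → ℝ}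
    {b b' : Option (Fin d × Bool) → Option (Fin d × Bool) → ℝ}
    (haa : ∀ x, a x = a' x)
    (ha : ∀ x, isFibreSlot x = true → a x = 0)
    (hb : ∀ x y, isFibreSlot x = true → isFibreSlot y = true → b x y = 0)
    (hbb : ∀ x y, isFibreSlot x = true ∨ isFibreSlot y = true → b x y = b' x y) :
    wedgeSum a b = wedgeSum a' b' := by
  refine Finset.sum_congr rfl fun σ _ => ?_
  rw [← haa]
  cases h0 : isFibreSlot (σ none) with
  | true => simp [ha _ h0]
  | false =>
    by_cases h : ∃ i, isFibreSlot (σ (some (i, false))) = true ∧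
        isFibreSlot (σ (some (i, true))) = true
    · obtain ⟨i, hi1, hi2⟩ := h
      rw [Finset.prod_eq_zero (Finset.mem_univ i) (hb _ _ hi1 hi2),
        Finset.prod_eq_zero (Finset.mem_univ i) ((hbb _ _ (Or.inl hi1)).symm.trans (hb _ _ hi1 hi2))]
    · push Not at h
      congr 1
      refine Finset.prod_congr rfl fun i _ => hbb _ _ (isFibreSlot_or_of_perm σ h0 ?_ i)
      intro i hi
      exact h i hi.1 hi.2

variable {V : Type*} [AddCommGroup V] [Module ℝ V]

/-- The multilinear map `v ↦ a(v₀) ∏ᵢ b(v₂ᵢ₊₁, v₂ᵢ₊₂)`. -/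
def tensorPow {d : ℕ} (a : V →ₗ[ℝ] ℝ) (b : V →ₗ[ℝ] V →ₗ[ℝ] ℝ) :
    MultilinearMap ℝ (fun _ : Option (Fin d × Bool) => V) ℝ :=
  MultilinearMap.mk' (fun v => a (v none) * ∏ i : Fin d, b (v (some (i, false))) (v (some (i, true))))
    (by
      intro v j x y
      rcases j with _ | ⟨k, c⟩
      · simp [add_mul]
      · simp only [ne_eq, reduceCtorEq, not_false_eq_true, Function.update_of_ne]
        rw [← mul_add, ← Finset.mul_prod_erase _ _ (Finset.mem_univ k),
          ← Finset.mul_prod_erase _ _ (Finset.mem_univ k),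
          ← Finset.mul_prod_erase _ _ (Finset.mem_univ k)]
        have hE : ∀ z : V, ∏ i ∈ Finset.univ.erase k,
            b (Function.update v (some (k, c)) z (some (i, false)))
              (Function.update v (some (k, c)) z (some (i, true))) =
            ∏ i ∈ Finset.univ.erase k, b (v (some (i, false))) (v (some (i, true))) := by
          intro z
          refine Finset.prod_congr rfl fun i hi => ?_
          have hik : i ≠ k := Finset.ne_of_mem_erase hi
          rw [Function.update_of_ne (by simp [hik]), Function.update_of_ne (by simp [hik])]
        rw [hE, hE, hE, ← add_mul]
        congr 2
        cases c <;> simp)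
    (by
      intro v j t x
      rcases j with _ | ⟨k, c⟩
      · simp [mul_assoc]
      · simp only [ne_eq, reduceCtorEq, not_false_eq_true, Function.update_of_ne]
        rw [← Finset.mul_prod_erase _ _ (Finset.mem_univ k),
          ← Finset.mul_prod_erase _ _ (Finset.mem_univ k)]
        have hE : ∀ z : V, ∏ i ∈ Finset.univ.erase k,
            b (Function.update v (some (k, c)) z (some (i, false)))
              (Function.update v (some (k, c)) z (some (i, true))) =
            ∏ i ∈ Finset.univ.erase k, b (v (some (i, false))) (v (some (i, true))) := by
          intro z
          refine Finset.prod_congr rfl fun i hi => ?_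
          have hik : i ≠ k := Finset.ne_of_mem_erase hi
          rw [Function.update_of_ne (by simp [hik]), Function.update_of_ne (by simp [hik])]
        rw [hE, hE]
        cases c <;> simp <;> ring)

/-- As an alternatization, the signed sum is a top-degree alternating map, so that pulling both
forms back by a linear map only costs a determinant. -/
lemma wedgeSum_eq_alternatization {d : ℕ} (a : V →ₗ[ℝ] ℝ) (b : V →ₗ[ℝ] V →ₗ[ℝ] ℝ)
    (v : Option (Fin d × Bool) → V) :
    wedgeSum (fun x => a (v x)) (fun x y => b (v x) (v y)) =
      MultilinearMap.alternatization (tensorPow (d := d) a b) v := by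
  rw [MultilinearMap.alternatization_apply]
  refine Finset.sum_congr rfl fun σ _ => ?_
  rw [MultilinearMap.domDomCongr_apply, Units.smul_def, zsmul_eq_mul, mul_assoc]
  rfl

/-- A top-degree alternating map is multiplied by `det T` under the linear map `T`. -/
lemma alternatingMap_comp_det {ι : Type*} [DecidableEq ι] [Fintype ι] (e : Module.Basis ι ℝ V)
    (f : V [⋀^ι]→ₗ[ℝ] ℝ) (T : V →ₗ[ℝ] V) (v : ι → V) :
    f (T ∘ v) = LinearMap.det T * f v := by
  rw [f.eq_smul_basis_det e, AlternatingMap.smul_apply, AlternatingMap.smul_apply,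
    Module.Basis.det_comp, smul_eq_mul, smul_eq_mul]
  ring

lemma wedgeSum_comp_det {d : ℕ} (e : Module.Basis (Option (Fin d × Bool)) ℝ V)
    (a : V →ₗ[ℝ] ℝ) (b : V →ₗ[ℝ] V →ₗ[ℝ] ℝ) (T : V →ₗ[ℝ] V) (v : Option (Fin d × Bool) → V) :
    wedgeSum (fun x => a (T (v x))) (fun x y => b (T (v x)) (T (v y))) =
      LinearMap.det T * wedgeSum (fun x => a (v x)) (fun x y => b (v x) (v y)) := by
  rw [wedgeSum_eq_alternatization a b v, ← alternatingMap_comp_det e]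
  exact wedgeSum_eq_alternatization a b (T ∘ v)

variable (d : ℕ)

/-- The base vector `∂/∂yᵢ`. -/
abbrev baseVec {d : ℕ} (i : Fin (d + 1)) : HCoord d := (EuclideanSpace.single i 1, 0)

/-- The fibre vector `∂/∂wₖ`. -/
abbrev fibreVec {d : ℕ} (k : Fin d) : HCoord d := (0, EuclideanSpace.single k 1)

/-- The linear form `dy₀`. -/
def stdForm : HCoord d →ₗ[ℝ] ℝ :=
  (EuclideanSpace.proj (𝕜 := ℝ) (0 : Fin (d + 1))).toLinearMap ∘ₗ LinearMap.fst ℝ _ _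

/-- The alternating form `∑ₖ dyₖ₊₁ ∧ dwₖ`. -/
def stdTwoForm : HCoord d →ₗ[ℝ] HCoord d →ₗ[ℝ] ℝ :=
  LinearMap.mk₂ ℝ (fun p q => ∑ k : Fin d, (p.1 k.succ * q.2 k - q.1 k.succ * p.2 k))
    (by intro p p' q; rw [← Finset.sum_add_distrib]; congr 1; ext k; simp; ring)
    (by intro c p q; rw [smul_eq_mul, Finset.mul_sum]; congr 1; ext k; simp; ring)
    (by intro p p' q; rw [← Finset.sum_add_distrib]; congr 1; ext k; simp; ring)
    (by intro c p q; rw [smul_eq_mul, Finset.mul_sum]; congr 1; ext k; simp; ring)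

/-- The value of `dy₀ ∧ (∑ₖ dyₖ₊₁ ∧ dwₖ)ᵈ` on the coordinate frame. -/
def wedgeConst : ℝ :=
  ((2 : ℝ) ^ d)⁻¹ * wedgeSum (fun x => stdForm d (coordFrame d x))
    (fun x y => stdTwoForm d (coordFrame d x) (coordFrame d y))

lemma exists_basis_hcoord : Nonempty (Module.Basis (Option (Fin d × Bool)) ℝ (HCoord d)) := by
  refine ⟨(Module.finBasis ℝ (HCoord d)).reindex (Fintype.equivOfCardEq ?_)⟩
  simp
  ring

variable {d}

/-- The endomorphism of `HCoord d` given by `N` on base vectors and the identity on fibres. -/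
def baseMap (N : Matrix (Fin (d + 1)) (Fin (d + 1)) ℝ) : HCoord d →ₗ[ℝ] HCoord d :=
  LinearMap.prodMap (Matrix.toEuclideanLin N.transpose) LinearMap.id

lemma det_baseMap (N : Matrix (Fin (d + 1)) (Fin (d + 1)) ℝ) :
    LinearMap.det (baseMap N) = N.det := by
  rw [baseMap, LinearMap.det_prodMap, LinearMap.det_id, mul_one]
  rw [Matrix.toEuclideanLin_eq_toLin_orthonormal, LinearMap.det_toLin, Matrix.det_transpose]

lemma baseMap_baseVec (N : Matrix (Fin (d + 1)) (Fin (d + 1)) ℝ) (i : Fin (d + 1)) :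
    baseMap N (baseVec i) = (WithLp.toLp 2 (fun j => N i j), 0) := by
  refine Prod.ext ?_ rfl
  ext j
  simp [baseMap, Matrix.toLpLin_apply]

lemma baseMap_fibreVec (N : Matrix (Fin (d + 1)) (Fin (d + 1)) ℝ) (k : Fin d) :
    baseMap N (fibreVec k) = fibreVec k := by
  simp [baseMap]

/-- `a ∧ bᵈ` evaluated on the coordinate frame is, up to a universal factor, the determinant of the
matrix of the values of `a` and of the mixed values of `b`, provided that `a` is horizontal and `b`
vanishes on fibres. -/
theorem wedgePow_coordFrame (a : HCoord d →L[ℝ] ℝ) (b : HCoord d [⋀^Fin 2]→L[ℝ] ℝ)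
    (ha : ∀ k, a (fibreVec k) = 0) (hb : ∀ k l, b ![fibreVec k, fibreVec l] = 0) :
    wedgePow a b (coordFrame d) = wedgeConst d *
      (Matrix.of fun i : Fin (d + 1) => (Fin.cons (a (baseVec i))
        (fun k : Fin d => b ![baseVec i, fibreVec k]) : Fin (d + 1) → ℝ)).det := by
  set N : Matrix (Fin (d + 1)) (Fin (d + 1)) ℝ := Matrix.of fun i : Fin (d + 1) =>
    (Fin.cons (a (baseVec i)) (fun k : Fin d => b ![baseVec i, fibreVec k]) : Fin (d + 1) → ℝ)
    with hN
  obtain ⟨e⟩ := exists_basis_hcoord d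
  have hswap : ∀ p q : HCoord d, b ![p, q] = - b ![q, p] := by
    intro p q
    have := b.toAlternatingMap.map_swap ![q, p] (i := 0) (j := 1) (by decide)
    have h2 : (![q, p] ∘ (Equiv.swap (0 : Fin 2) 1)) = ![p, q] := by
      funext i; fin_cases i <;> simp
    rw [h2] at this
    exact this
  have hA : ∀ i, stdForm d (baseMap N (baseVec i)) = a (baseVec i) := by
    intro i; rw [baseMap_baseVec]; simp [stdForm, hN]
  have hAw : ∀ k, stdForm d (baseMap N (fibreVec k)) = 0 := by
    intro k; rw [baseMap_fibreVec]; simp [stdForm]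
  have hB : ∀ i k, stdTwoForm d (baseMap N (baseVec i)) (baseMap N (fibreVec k)) =
      b ![baseVec i, fibreVec k] := by
    intro i k
    rw [baseMap_fibreVec, baseMap_baseVec]
    simp [stdTwoForm, hN]
  have hB' : ∀ i k, stdTwoForm d (baseMap N (fibreVec k)) (baseMap N (baseVec i)) =
      b ![fibreVec k, baseVec i] := by
    intro i k
    rw [hswap, ← hB]
    simp [stdTwoForm]
  have hBw : ∀ k l, stdTwoForm d (baseMap N (fibreVec k)) (baseMap N (fibreVec l)) = 0 := by
    intro k l
    rw [baseMap_fibreVec, baseMap_fibreVec]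
    simp [stdTwoForm]
  -- The pullbacks of the standard forms by `baseMap N` have the same values as `a` and `b`, except
  -- perhaps on pairs of base vectors, and those values do not contribute.
  have key : wedgeSum (fun x => a (coordFrame d x))
      (fun x y => b ![coordFrame d x, coordFrame d y]) =
      wedgeSum (fun x => stdForm d (baseMap N (coordFrame d x)))
        (fun x y => stdTwoForm d (baseMap N (coordFrame d x)) (baseMap N (coordFrame d y))) := by
    apply wedgeSum_congr
    · rintro (_ | ⟨i, _ | _⟩)
      · exact (hA 0).symm
      · exact (hA i.succ).symm
      · exact (ha i).trans (hAw i).symm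
    · rintro (_ | ⟨i, _ | _⟩) h
      · simp [isFibreSlot] at h
      · simp [isFibreSlot] at h
      · exact ha i
    · rintro (_ | ⟨i, _ | _⟩) (_ | ⟨j, _ | _⟩) h h'
      all_goals first
        | (simp [isFibreSlot] at h; done)
        | (simp [isFibreSlot] at h'; done)
        | exact hb i j
    · rintro (_ | ⟨i, _ | _⟩) (_ | ⟨j, _ | _⟩) h
      · simp [isFibreSlot] at h
      · simp [isFibreSlot] at h
      · exact (hB 0 j).symm
      · simp [isFibreSlot] at h
      · simp [isFibreSlot] at h
      · exact (hB i.succ j).symm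
      · exact (hB' 0 i).symm
      · exact (hB' j.succ i).symm
      · exact (hb i j).trans (hBw i j).symm
  have : wedgePow a b (coordFrame d) = ((2 : ℝ) ^ d)⁻¹ * wedgeSum (fun x => a (coordFrame d x))
      (fun x y => b ![coordFrame d x, coordFrame d y]) := rfl
  rw [this, key, wedgeSum_comp_det e, det_baseMap, wedgeConst]
  ring

end WedgeAlgebra

end Finsler

end

/-! ### Minkowski norms, the fundamental inequality and injectivity of the momentum -/

noncomputable section

namespace Finsler

variable {d : ℕ}

/-- Minkowski norms on `ℝⁿ`: the restrictions of Finsler metrics to tangent spaces. -/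
structure IsMinkowskiNorm (φ : Model d → ℝ) : Prop where
  contDiffAt : ∀ v, v ≠ 0 → ContDiffAt ℝ ∞ φ v
  map_zero : φ 0 = 0
  pos : ∀ v, v ≠ 0 → 0 < φ v
  homogeneous : ∀ (v : Model d) (t : ℝ), 0 < t → φ (t • v) = t * φ v
  hessian_pos : ∀ v u : Model d, v ≠ 0 → u ≠ 0 →
    0 < fderiv ℝ (fderiv ℝ (fun w => φ w ^ 2)) v u u

/-- A function lies strictly above its tangent line if its second derivative is positive. -/
lemma tangent_lt_of_second_deriv_pos {h h' h'' : ℝ → ℝ}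
    (H : ∀ t ∈ Icc (0 : ℝ) 1, HasDerivAt h (h' t) t)
    (H' : ∀ t ∈ Icc (0 : ℝ) 1, HasDerivAt h' (h'' t) t)
    (pos : ∀ t ∈ Icc (0 : ℝ) 1, 0 < h'' t) : h 0 + h' 0 < h 1 := by
  obtain ⟨c, hc, hc'⟩ := exists_hasDerivAt_eq_slope h h' (a := 0) (b := 1) one_pos
    (fun t ht => (H t ht).continuousAt.continuousWithinAt) (fun t ht => H t (Ioo_subset_Icc_self ht))
  have hsub : Icc 0 c ⊆ Icc (0 : ℝ) 1 := Icc_subset_Icc le_rfl hc.2.le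
  obtain ⟨e, he, he'⟩ := exists_hasDerivAt_eq_slope h' h'' (a := 0) (b := c) hc.1
    (fun t ht => (H' t (hsub ht)).continuousAt.continuousWithinAt)
    (fun t ht => H' t (hsub (Ioo_subset_Icc_self ht)))
  have := pos e (hsub (Ioo_subset_Icc_self he))
  rw [he', sub_zero, div_pos_iff_of_pos_right hc.1] at this
  rw [sub_zero, div_one] at hc'
  linarith

namespace IsMinkowskiNorm

variable {φ : Model d → ℝ} (hφ : IsMinkowskiNorm φ)

include hφ

lemma nonneg (v : Model d) : 0 ≤ φ v := by
  by_cases h : v = 0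
  · rw [h, hφ.map_zero]
  · exact (hφ.pos v h).le

lemma differentiableAt {v : Model d} (hv : v ≠ 0) : DifferentiableAt ℝ φ v :=
  (hφ.contDiffAt v hv).differentiableAt (by simp)

/-- Euler's identity: differentiate the homogeneity relation in `t` at `t = 1`. -/
lemma fderiv_self {v : Model d} (hv : v ≠ 0) : fderiv ℝ φ v v = φ v := by
  have h1 : HasDerivAt (fun t : ℝ => φ (t • v)) (fderiv ℝ φ v v) 1 := by
    have h2 : HasDerivAt (fun t : ℝ => t • v) v 1 := by
      simpa using (hasDerivAt_id (1 : ℝ)).smul_const v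
    have h3 : HasFDerivAt φ (fderiv ℝ φ v) ((1 : ℝ) • v) := by
      rw [one_smul]; exact (hφ.differentiableAt hv).hasFDerivAt
    exact h3.comp_hasDerivAt 1 h2
  have h4 : HasDerivAt (fun t : ℝ => t * φ v) (φ v) 1 := by
    simpa using (hasDerivAt_id (1 : ℝ)).mul_const (φ v)
  have h5 : (fun t : ℝ => φ (t • v)) =ᶠ[nhds 1] fun t => t * φ v := by
    filter_upwards [lt_mem_nhds one_pos] with t ht
    exact hφ.homogeneous v t ht
  exact (h1.congr_of_eventuallyEq h5.symm).unique h4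

lemma fderiv_smul {v : Model d} (hv : v ≠ 0) {t : ℝ} (ht : 0 < t) :
    fderiv ℝ φ (t • v) = fderiv ℝ φ v := by
  have h1 : (fun x => φ (t • x)) = fun x => t • φ x := by
    ext x; exact hφ.homogeneous x t ht
  have h2 := fderiv_comp_smul (𝕜 := ℝ) (f := φ) (x := v) t
  rw [h1, fderiv_fun_const_smul (hφ.differentiableAt hv)] at h2
  have h3 := congrArg (fun L => t⁻¹ • L) h2
  simpa [smul_smul, ht.ne'] using h3.symm

/-- Strict convexity of φ² along the segment from `v` to `u` gives φ(v)² + 2φ(v)(dφ_v(u) - φ(v)) <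
φ(u)², which is the claim when φ(u) = φ(v). The segment has to avoid the origin, because the Hessian
is controlled only away from it. -/
lemma fderiv_lt_of_eq {v u : Model d} (huv : u ≠ v)
    (hseg : ∀ t ∈ Icc (0 : ℝ) 1, v + t • (u - v) ≠ 0) (heq : φ u = φ v) :
    fderiv ℝ φ v u < φ u := by
  set g : Model d → ℝ := fun w => φ w ^ 2 with hg
  have hgc : ∀ w, w ≠ 0 → ContDiffAt ℝ ∞ g w := fun w hw => (hφ.contDiffAt w hw).pow 2
  have hline : ∀ t : ℝ, HasDerivAt (fun t : ℝ => v + t • (u - v)) (u - v) t := fun t => by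
    simpa using ((hasDerivAt_id t).smul_const (u - v)).const_add v
  have H : ∀ t ∈ Icc (0 : ℝ) 1, HasDerivAt (fun t : ℝ => g (v + t • (u - v)))
      (fderiv ℝ g (v + t • (u - v)) (u - v)) t := by
    intro t ht
    have := ((hgc _ (hseg t ht)).differentiableAt (by simp)).hasFDerivAt
    exact this.comp_hasDerivAt t (hline t)
  have H' : ∀ t ∈ Icc (0 : ℝ) 1,
      HasDerivAt (fun t : ℝ => fderiv ℝ g (v + t • (u - v)) (u - v))
      (fderiv ℝ (fderiv ℝ g) (v + t • (u - v)) (u - v) (u - v)) t := by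
    intro t ht
    have h1 : ContDiffAt ℝ 1 (fderiv ℝ g) (v + t • (u - v)) :=
      (hgc _ (hseg t ht)).fderiv_right (by norm_cast)
    have h2 := (h1.differentiableAt (by simp)).hasFDerivAt.comp_hasDerivAt t (hline t)
    exact h2.clm_apply (hasDerivAt_const t (u - v)) |>.congr_deriv (by simp)
  have key := tangent_lt_of_second_deriv_pos H H'
    (fun t ht => hφ.hessian_pos _ _ (hseg t ht) (sub_ne_zero.2 huv))
  have hv : v ≠ 0 := by simpa using hseg 0 (by simp)
  have hd : fderiv ℝ g v = (2 * φ v) • fderiv ℝ φ v := by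
    have := ((hφ.differentiableAt hv).hasFDerivAt.pow 2).fderiv
    rw [hg, this]
    simp
  simp only [zero_smul, add_zero, one_smul, add_sub_cancel, hd, smul_apply,
    map_sub, hφ.fderiv_self hv, smul_eq_mul] at key
  simp only [hg, heq] at key
  have := hφ.pos v hv
  rw [heq]
  nlinarith

lemma smul_div_eq {v u : Model d} (hv : v ≠ 0) (hu : u ≠ 0) : φ ((φ v / φ u) • u) = φ v := by
  have h1 := hφ.pos v hv
  have h2 := hφ.pos u hu
  rw [hφ.homogeneous _ _ (by positivity)]
  field_simp

/-- The fundamental inequality of Finsler geometry. -/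
lemma fderiv_le {v : Model d} (hv : v ≠ 0) (u : Model d) : fderiv ℝ φ v u ≤ φ u := by
  by_cases hu : u = 0
  · simp [hu, hφ.map_zero]
  have hφv := hφ.pos v hv
  have hφu := hφ.pos u hu
  have hr : 0 < φ v / φ u := by positivity
  -- Both sides are positively homogeneous in `u`, so `u` may be moved to the level set of `v`.
  set u' := (φ v / φ u) • u with hu'
  have heq : φ u' = φ v := hφ.smul_div_eq hv hu
  suffices h : fderiv ℝ φ v u' ≤ φ u' by
    rw [hu', hφ.homogeneous _ _ hr, map_smul, smul_eq_mul] at h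
    exact le_of_mul_le_mul_left h hr
  by_cases huv : u' = v
  · rw [huv, hφ.fderiv_self hv]
  by_cases hseg : ∀ t ∈ Icc (0 : ℝ) 1, v + t • (u' - v) ≠ 0
  · exact (hφ.fderiv_lt_of_eq huv hseg heq).le
  -- If the segment meets the origin, applying dφ_v to (1 - t) v + t u' = 0 shows that dφ_v(u') ≤ 0.
  · push Not at hseg
    obtain ⟨t, ht, h0⟩ := hseg
    have ht0 : 0 < t := by
      rcases ht.1.eq_or_lt with h | h
      · exact absurd (by simpa [← h] using h0) hv
      · exact h
    have h1 := congrArg (fderiv ℝ φ v) h0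
    simp only [map_add, map_smul, map_sub, hφ.fderiv_self hv, smul_eq_mul,
      _root_.map_zero] at h1
    have h2 : t * fderiv ℝ φ v u' ≤ 0 := by nlinarith [ht.2]
    have h3 : fderiv ℝ φ v u' ≤ 0 := by
      by_contra h; push Not at h; nlinarith [mul_pos ht0 h]
    exact h3.trans (hφ.nonneg _)

end IsMinkowskiNorm

/-! ### Directions -/

lemma direction_zero (s : ℤˣ) (w : EuclideanSpace ℝ (Fin d)) :
    direction s w 0 = ((s : ℤ) : ℝ) := rfl

lemma direction_succ (s : ℤˣ) (w : EuclideanSpace ℝ (Fin d)) (k : Fin d) :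
    direction s w k.succ = w k := rfl

lemma unit_cast_ne_zero (s : ℤˣ) : ((s : ℤ) : ℝ) ≠ 0 := by
  exact_mod_cast s.ne_zero

lemma direction_ne_zero (s : ℤˣ) (w : EuclideanSpace ℝ (Fin d)) : direction s w ≠ 0 := by
  intro h
  have := congrArg (fun v : Model d => v 0) h
  simp [direction_zero] at this

lemma direction_injective (s : ℤˣ) :
    Function.Injective (direction (d := d) s) := by
  intro w w' h
  ext k
  have := congrArg (fun v : Model d => v k.succ) h
  simpa [direction_succ] using this

/-- The inclusion of the last `d` coordinates. -/
def consZero : EuclideanSpace ℝ (Fin d) →L[ℝ] Model d :=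
  LinearMap.toContinuousLinearMap
    { toFun := fun w => WithLp.toLp 2 (Fin.cons 0 (fun i => w i))
      map_add' := fun w w' => by
        ext i; refine Fin.cases ?_ (fun k => ?_) i <;> simp
      map_smul' := fun c w => by
        ext i; refine Fin.cases ?_ (fun k => ?_) i <;> simp }

/-- The projection on the last `d` coordinates. -/
def tail : Model d →L[ℝ] EuclideanSpace ℝ (Fin d) :=
  LinearMap.toContinuousLinearMap
    { toFun := fun v => WithLp.toLp 2 (fun i => v i.succ)
      map_add' := fun w w' => by ext i; simp
      map_smul' := fun c w => by ext i; simp }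

@[simp] lemma tail_apply (v : Model d) (k : Fin d) : tail v k = v k.succ := rfl

lemma direction_eq (s : ℤˣ) (w : EuclideanSpace ℝ (Fin d)) :
    direction s w = direction s 0 + consZero w := by
  ext i; refine Fin.cases ?_ (fun k => ?_) i <;> simp [direction, consZero]

lemma hasFDerivAt_direction (s : ℤˣ) (w : EuclideanSpace ℝ (Fin d)) :
    HasFDerivAt (direction s) consZero w := by
  have : direction (d := d) s = fun w => direction s 0 + consZero w :=
    funext (direction_eq s)
  rw [this]
  exact consZero.hasFDerivAt.const_add _

lemma contDiff_direction (s : ℤˣ) {n : WithTop ℕ∞} : ContDiff ℝ n (direction (d := d) s) := by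
  have : direction (d := d) s = fun w => direction s 0 + consZero w :=
    funext (direction_eq s)
  rw [this]
  exact contDiff_const.add consZero.contDiff

/-- A vector off the equator is a positive multiple of some `direction s w`. -/
lemma exists_eq_smul_direction {v : Model d} (hv : v 0 ≠ 0) :
    ∃ (s : ℤˣ) (t : ℝ) (w : EuclideanSpace ℝ (Fin d)), 0 < t ∧ v = t • direction s w := by
  obtain ⟨s, hs⟩ : ∃ s : ℤˣ, v 0 = |v 0| * ((s : ℤ) : ℝ) := by
    rcases lt_or_gt_of_ne hv with h | h
    · exact ⟨-1, by simp [abs_of_neg h]⟩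
    · exact ⟨1, by simp [abs_of_pos h]⟩
  refine ⟨s, |v 0|, |v 0|⁻¹ • tail v, abs_pos.2 hv, ?_⟩
  ext i
  refine Fin.cases ?_ (fun k => ?_) i
  · simpa [direction_zero] using hs
  · simp [direction_succ, hv]

namespace IsMinkowskiNorm

variable {φ : Model d → ℝ} (hφ : IsMinkowskiNorm φ)

include hφ

/-- If v and u had the same momentum, then after rescaling u to the level of v the strict inequality
dφ_v(u) < φ(u) would contradict dφ_v(u) = dφ_u(u) = φ(u). Both vectors have zeroth coordinate `s`,
so the segment between them avoids the origin, and they are proportional only if equal. -/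
lemma fderiv_direction_injective (s : ℤˣ) :
    Function.Injective (fun w => fderiv ℝ φ (direction s w)) := by
  intro w w' h
  have h : fderiv ℝ φ (direction s w) = fderiv ℝ φ (direction s w') := h
  by_contra hne
  have hv := direction_ne_zero s w
  have hu := direction_ne_zero s w'
  set v := direction s w with hvdef
  set u := direction s w' with hudef
  have hφv := hφ.pos v hv
  have hφu := hφ.pos u hu
  have hr : 0 < φ v / φ u := by positivity
  have hs := unit_cast_ne_zero s
  have hv0 : v 0 = ((s : ℤ) : ℝ) := rfl
  have hu0 : u 0 = ((s : ℤ) : ℝ) := rfl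
  have hlt := hφ.fderiv_lt_of_eq (v := v) (u := (φ v / φ u) • u) ?_ ?_ (hφ.smul_div_eq hv hu)
  · rw [hφ.homogeneous _ _ hr, map_smul, smul_eq_mul, h, hφ.fderiv_self hu] at hlt
    exact lt_irrefl _ hlt
  · intro hcontra
    have h0 := congrArg (fun x : Model d => x 0) hcontra
    simp only [PiLp.smul_apply, smul_eq_mul, hv0, hu0] at h0
    have h1 : φ v / φ u = 1 := by
      field_simp at h0 ⊢
      exact h0
    rw [h1, one_smul] at hcontra
    exact hne (direction_injective s hcontra).symm
  · intro t ht h0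
    have h0 := congrArg (fun x : Model d => x 0) h0
    simp only [PiLp.add_apply, PiLp.smul_apply, PiLp.sub_apply, smul_eq_mul, hv0, hu0,
      PiLp.zero_apply] at h0
    have h2 : (1 - t + t * (φ v / φ u)) * ((s : ℤ) : ℝ) = 0 := by linear_combination h0
    rcases mul_eq_zero.1 h2 with h3 | h3
    · rcases ht.1.eq_or_lt with h4 | h4
      · rw [← h4] at h3; norm_num at h3
      · nlinarith [mul_pos h4 hr, ht.2]
    · exact hs h3

end IsMinkowskiNorm

end Finsler

end

noncomputable section

namespace Finsler

variable {d : ℕ}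

/-! ### The dual norm -/

/-- The vector of `ℝⁿ` that represents a covector. -/
def covec : (Model d →L[ℝ] ℝ) →L[ℝ] Model d :=
  LinearMap.toContinuousLinearMap
    { toFun := fun L => WithLp.toLp 2 (fun i => L (EuclideanSpace.single i 1))
      map_add' := fun _ _ => by ext i; simp
      map_smul' := fun _ _ => by ext i; simp }

lemma covec_apply (L : Model d →L[ℝ] ℝ) (i : Fin (d + 1)) :
    covec L i = L (EuclideanSpace.single i 1) := rfl

lemma inner_covec (L : Model d →L[ℝ] ℝ) (v : Model d) : inner ℝ (covec L) v = L v := by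
  have hv : v = ∑ i, v i • EuclideanSpace.single i (1 : ℝ) := by
    ext j
    simp [Pi.single_apply]
  conv_rhs => rw [hv]
  simp [PiLp.inner_apply, covec_apply]

lemma covec_eq_iff (L : Model d →L[ℝ] ℝ) (ξ : Model d) :
    covec L = ξ ↔ ∀ v, L v = inner ℝ ξ v := by
  refine ⟨fun h v => by rw [← inner_covec, h], fun h => ?_⟩
  refine ext_inner_right ℝ fun v => ?_
  rw [inner_covec, h]

lemma covec_injective : Function.Injective (covec (d := d)) := by
  intro L L' h
  ext v
  rw [← inner_covec, h, inner_covec]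

/-- The norm dual to `φ`. -/
def dualNorm (φ : Model d → ℝ) (ξ : Model d) : ℝ :=
  sSup ((fun v => inner ℝ ξ v / φ v) '' Metric.sphere (0 : Model d) 1)

/-- The unit ball of the dual norm. -/
def dualBall (φ : Model d → ℝ) : Set (Model d) := {ξ | ∀ v, inner ℝ ξ v ≤ φ v}

lemma isClosed_dualBall (φ : Model d → ℝ) : IsClosed (dualBall φ) := by
  rw [dualBall, ofPred_forall]
  exact isClosed_iInter fun v => isClosed_le (by fun_prop) continuous_const

namespace IsMinkowskiNorm

variable {φ : Model d → ℝ} (hφ : IsMinkowskiNorm φ)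

include hφ

/-- The quotient has a maximum on the compact Euclidean sphere. Homogeneity extends the bound to all
vectors and normalizes the maximizer to φ = 1. -/
lemma dualNorm_spec (ξ : Model d) : (∀ v, inner ℝ ξ v ≤ dualNorm φ ξ * φ v) ∧
    ∃ v, φ v = 1 ∧ v ≠ 0 ∧ inner ℝ ξ v = dualNorm φ ξ := by
  have hne : ∀ v ∈ Metric.sphere (0 : Model d) 1, v ≠ 0 := fun v hv =>
    ne_zero_of_mem_unit_sphere ⟨v, hv⟩
  have hcont : ContinuousOn (fun v => inner ℝ ξ v / φ v) (Metric.sphere (0 : Model d) 1) := by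
    refine ContinuousOn.div (by fun_prop) ?_ fun v hv => (hφ.pos v (hne v hv)).ne'
    exact fun v hv => (hφ.contDiffAt v (hne v hv)).continuousAt.continuousWithinAt
  obtain ⟨u, hu, hsup, hmax⟩ := (isCompact_sphere (0 : Model d) 1).exists_sSup_image_eq_and_ge
    (NormedSpace.sphere_nonempty.2 zero_le_one) hcont
  have hu0 := hne u hu
  have hφu := hφ.pos u hu0
  have hG : dualNorm φ ξ = inner ℝ ξ u / φ u := hsup
  refine ⟨fun v => ?_, (φ u)⁻¹ • u, ?_, ?_, ?_⟩
  · by_cases hv : v = 0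
    · simp [hv, hφ.map_zero]
    · have hn : 0 < ‖v‖ := norm_pos_iff.2 hv
      have h1 := hmax (‖v‖⁻¹ • v) (by simp [norm_smul, hv])
      have hφv := hφ.pos v hv
      rw [hφ.homogeneous _ _ (by positivity), inner_smul_right,
        mul_div_mul_left _ _ (by positivity), ← hG] at h1
      rwa [div_le_iff₀ hφv] at h1
  · rw [hφ.homogeneous _ _ (by positivity), inv_mul_cancel₀ hφu.ne']
  · exact smul_ne_zero (by positivity) hu0
  · rw [inner_smul_right, hG]; ring

lemma inner_le (ξ v : Model d) : inner ℝ ξ v ≤ dualNorm φ ξ * φ v := (hφ.dualNorm_spec ξ).1 v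

lemma exists_inner_eq (ξ : Model d) : ∃ v, φ v = 1 ∧ v ≠ 0 ∧ inner ℝ ξ v = dualNorm φ ξ :=
  (hφ.dualNorm_spec ξ).2

lemma dualNorm_le {ξ : Model d} {c : ℝ} (h : ∀ v, inner ℝ ξ v ≤ c * φ v) : dualNorm φ ξ ≤ c := by
  obtain ⟨v, h1, -, h2⟩ := hφ.exists_inner_eq ξ
  rw [← h2]
  simpa [h1] using h v

lemma mem_dualBall_iff {ξ : Model d} : ξ ∈ dualBall φ ↔ dualNorm φ ξ ≤ 1 := by
  refine ⟨fun h => hφ.dualNorm_le fun v => by simpa using h v, fun h v => ?_⟩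
  exact (hφ.inner_le ξ v).trans (mul_le_of_le_one_left (hφ.nonneg v) h)

lemma dualNorm_add_le (ξ ζ : Model d) : dualNorm φ (ξ + ζ) ≤ dualNorm φ ξ + dualNorm φ ζ :=
  hφ.dualNorm_le fun v => by
    rw [inner_add_left, add_mul]
    exact add_le_add (hφ.inner_le ξ v) (hφ.inner_le ζ v)

lemma dualNorm_smul (ξ : Model d) {t : ℝ} (ht : 0 < t) :
    dualNorm φ (t • ξ) = t * dualNorm φ ξ := by
  have key : ∀ (ξ : Model d) {t : ℝ}, 0 < t → dualNorm φ (t • ξ) ≤ t * dualNorm φ ξ := by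
    intro ξ t ht
    refine hφ.dualNorm_le fun v => ?_
    rw [real_inner_smul_left, mul_assoc]
    exact mul_le_mul_of_nonneg_left (hφ.inner_le ξ v) ht.le
  refine le_antisymm (key ξ ht) ?_
  have h := key (t • ξ) (inv_pos.2 ht)
  rw [smul_smul, inv_mul_cancel₀ ht.ne', one_smul] at h
  rwa [le_inv_mul_iff₀ ht] at h

lemma dualNorm_pos {ξ : Model d} (hξ : ξ ≠ 0) : 0 < dualNorm φ ξ := by
  have h1 := hφ.inner_le ξ ξ
  have h2 : 0 < inner ℝ ξ ξ := real_inner_self_pos.2 hξ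
  exact pos_of_mul_pos_left (h2.trans_le h1) (hφ.nonneg ξ)

lemma dualNorm_nonneg (ξ : Model d) : 0 ≤ dualNorm φ ξ := by
  by_cases h : ξ = 0
  · obtain ⟨v, -, -, h2⟩ := hφ.exists_inner_eq ξ
    rw [← h2, h]; simp
  · exact (hφ.dualNorm_pos h).le

lemma neg_inner_le {c : ℝ} (hc : ∀ v, φ (-v) ≤ c * φ v) (ξ v : Model d) :
    - inner ℝ ξ v ≤ c * dualNorm φ ξ * φ v := by
  have h := hφ.inner_le ξ (-v)
  rw [inner_neg_right] at h
  refine h.trans ?_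
  calc dualNorm φ ξ * φ (-v) ≤ dualNorm φ ξ * (c * φ v) :=
        mul_le_mul_of_nonneg_left (hc v) (hφ.dualNorm_nonneg ξ)
    _ = _ := by ring

lemma dualNorm_neg_le {c : ℝ} (hc : ∀ v, φ (-v) ≤ c * φ v) (ξ : Model d) :
    dualNorm φ (-ξ) ≤ c * dualNorm φ ξ :=
  hφ.dualNorm_le fun v => by
    rw [inner_neg_left]
    exact hφ.neg_inner_le hc ξ v

/-- The upper bound is the fundamental inequality; Euler's identity at `v` gives equality. -/
lemma dualNorm_covec_fderiv {v : Model d} (hv : v ≠ 0) :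
    dualNorm φ (covec (fderiv ℝ φ v)) = 1 := by
  refine le_antisymm (hφ.dualNorm_le fun u => ?_) ?_
  · rw [inner_covec, one_mul]; exact hφ.fderiv_le hv u
  · have := hφ.inner_le (covec (fderiv ℝ φ v)) v
    rw [inner_covec, hφ.fderiv_self hv] at this
    exact le_of_mul_le_mul_right (by simpa using this) (hφ.pos v hv)

/-- A vector that realizes the dual norm of `ξ` is mapped to the ray of `ξ` by `dφ`. -/
lemma eq_smul_covec_fderiv {ξ v : Model d} (hv : v ≠ 0) (h1 : φ v = 1)
    (h : inner ℝ ξ v = dualNorm φ ξ) : ξ = dualNorm φ ξ • covec (fderiv ℝ φ v) := by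
  -- `v` minimizes φ*(ξ) φ - ξ, a nonnegative function that vanishes there. Its derivative at `v` is
  -- therefore zero.
  have hmin : IsLocalMin (fun u => dualNorm φ ξ * φ u - inner ℝ ξ u) v := by
    refine Filter.Eventually.of_forall fun u => ?_
    have := hφ.inner_le ξ u
    simp only [h, h1]
    linarith
  have hd : HasFDerivAt (fun u => dualNorm φ ξ * φ u - inner ℝ ξ u)
      (dualNorm φ ξ • fderiv ℝ φ v - innerSL ℝ ξ) v :=
    ((hφ.differentiableAt hv).hasFDerivAt.const_mul _).sub (innerSL ℝ ξ).hasFDerivAt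
  have h0 := hmin.hasFDerivAt_eq_zero hd
  rw [← map_smul, eq_comm, covec_eq_iff]
  intro u
  have := congrArg (fun L : Model d →L[ℝ] ℝ => L u) h0
  simp only [sub_apply, innerSL_apply_apply, zero_apply] at this
  linarith

lemma contDiff_fderiv_direction (s : ℤˣ) :
    ContDiff ℝ ∞ (fun w => fderiv ℝ φ (direction s w)) := by
  rw [contDiff_iff_contDiffAt]
  intro w
  have h := (hφ.contDiffAt _ (direction_ne_zero s w)).fderiv_right (m := ∞) (by simp)
  exact ContDiffAt.comp w h (contDiff_direction s).contDiffAt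

end IsMinkowskiNorm

/-! ### Polar coordinates on the dual ball -/

/-- The matrix with columns `p, ∂p/∂w₁, …, ∂p/∂w_d`, where `p(w)` is the derivative of `φ` at
`direction s w`. -/
def polarMatrix (φ : Model d → ℝ) (s : ℤˣ) (w : EuclideanSpace ℝ (Fin d)) :
    Matrix (Fin (d + 1)) (Fin (d + 1)) ℝ :=
  Matrix.of fun i => (Fin.cons (fderiv ℝ φ (direction s w) (EuclideanSpace.single i 1))
    (fun k : Fin d => fderiv ℝ (fun w => fderiv ℝ φ (direction s w)) w (EuclideanSpace.single k 1)
      (EuclideanSpace.single i 1)) : Fin (d + 1) → ℝ)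

/-- Polar coordinates `(r, w) ↦ r p(w)` on the dual space. -/
def polarMap (φ : Model d → ℝ) (s : ℤˣ) (x : Model d) : Model d :=
  x 0 • covec (fderiv ℝ φ (direction s (tail x)))

/-- The derivative of `polarMap`. -/
def polarDeriv (φ : Model d → ℝ) (s : ℤˣ) (x : Model d) : Model d →L[ℝ] Model d :=
  x 0 • (covec ∘L (fderiv ℝ (fun w => fderiv ℝ φ (direction s w)) (tail x)) ∘L tail) +
    (EuclideanSpace.proj (𝕜 := ℝ) (0 : Fin (d + 1))).smulRight
      (covec (fderiv ℝ φ (direction s (tail x))))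

variable (d) in
/-- The slab `{0 < x₀ < 1}`. -/
def slab : Set (Model d) := {x | 0 < x 0 ∧ x 0 < 1}

lemma measurableSet_slab : MeasurableSet (slab d) := by
  have h : Measurable fun x : Model d => x 0 :=
    (EuclideanSpace.proj (𝕜 := ℝ) (0 : Fin (d + 1))).measurable
  exact (measurableSet_lt measurable_const h).inter (measurableSet_lt h measurable_const)

/-- The radial column is p itself and each of the `d` angular columns is `x 0` times a derivative of
p, so `x 0 ^ d` factors out. -/
lemma det_polarDeriv (φ : Model d → ℝ) (s : ℤˣ) (x : Model d) :
    (polarDeriv φ s x).det = x 0 ^ d * (polarMatrix φ s (tail x)).det := by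
  have h : (polarDeriv φ s x).det = (Matrix.of fun i j =>
      (Fin.cons 1 (fun _ => x 0) : Fin (d + 1) → ℝ) j * polarMatrix φ s (tail x) i j).det := by
    rw [ContinuousLinearMap.det,
      ← LinearMap.det_toMatrix (EuclideanSpace.basisFun (Fin (d + 1)) ℝ).toBasis]
    congr 1
    ext i j
    rw [LinearMap.toMatrix_apply]
    refine Fin.cases ?_ (fun k => ?_) j
    · have : tail (EuclideanSpace.single (0 : Fin (d + 1)) (1 : ℝ)) = 0 := by
        ext k; simp
      simp [polarDeriv, polarMatrix, this, covec_apply]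
    · have : tail (EuclideanSpace.single k.succ (1 : ℝ)) = EuclideanSpace.single k 1 := by
        ext l; simp
      simp [polarDeriv, polarMatrix, this, covec_apply]
  rw [h, Matrix.det_mul_row, Fin.prod_univ_succ]
  simp

namespace IsMinkowskiNorm

variable {φ : Model d → ℝ} (hφ : IsMinkowskiNorm φ)

include hφ

lemma hasFDerivAt_polarMap (s : ℤˣ) (x : Model d) :
    HasFDerivAt (polarMap φ s) (polarDeriv φ s x) x := by
  have h1 := (((hφ.contDiff_fderiv_direction s).differentiable (by simp)) (tail x)).hasFDerivAt
  have h2 := covec.hasFDerivAt.comp x (h1.comp x tail.hasFDerivAt)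
  exact (EuclideanSpace.proj (𝕜 := ℝ) (0 : Fin (d + 1))).hasFDerivAt.smul h2

lemma dualNorm_polarMap (s : ℤˣ) {x : Model d} (hx : 0 < x 0) :
    dualNorm φ (polarMap φ s x) = x 0 := by
  rw [polarMap, hφ.dualNorm_smul _ hx, hφ.dualNorm_covec_fderiv (direction_ne_zero _ _), mul_one]

/-- The radius is recovered as the dual norm of the image, and then the direction from the
injectivity of the momentum. -/
lemma injOn_polarMap (s : ℤˣ) : InjOn (polarMap φ s) (slab d) := by
  intro x hx y hy h
  have h0 : x 0 = y 0 := by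
    rw [← hφ.dualNorm_polarMap s hx.1, ← hφ.dualNorm_polarMap s hy.1, h]
  have h1 : tail x = tail y := by
    apply hφ.fderiv_direction_injective s
    apply covec_injective
    rw [polarMap, polarMap, h0] at h
    exact smul_right_injective _ hy.1.ne' h
  ext i
  refine Fin.cases h0 (fun k => ?_) i
  exact congrArg (fun w : EuclideanSpace ℝ (Fin d) => w k) h1

lemma continuous_polarMatrix_det (s : ℤˣ) : Continuous fun w => (polarMatrix φ s w).det := by
  refine Continuous.matrix_det ?_
  refine continuous_matrix fun i j => ?_
  have h := hφ.contDiff_fderiv_direction s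
  refine Fin.cases ?_ (fun k => ?_) j
  · exact h.continuous.clm_apply continuous_const
  · exact ((h.continuous_fderiv (by simp)).clm_apply continuous_const).clm_apply continuous_const

end IsMinkowskiNorm

lemma measurePreserving_cons : MeasurePreserving
    (fun x : Model d => (x 0, tail x)) volume volume := by
  have h1 := EuclideanSpace.volume_preserving_symm_measurableEquiv_toLp (Fin (d + 1))
  have h2 := volume_preserving_piFinSuccAbove (fun _ : Fin (d + 1) => ℝ) 0
  have h3 := (EuclideanSpace.volume_preserving_symm_measurableEquiv_toLp (Fin d)).symm
  have h4 := (MeasurePreserving.id (volume : Measure ℝ)).prod h3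
  exact h4.comp (h2.comp h1)

lemma lintegral_slab (g : EuclideanSpace ℝ (Fin d) → ℝ≥0∞) (hg : Measurable g) :
    ∫⁻ x in slab d, ENNReal.ofReal (x 0 ^ d) * g (tail x) =
      (∫⁻ r in Ioo (0 : ℝ) 1, ENNReal.ofReal (r ^ d)) * ∫⁻ w, g w := by
  have h1 : slab d = (fun x : Model d => (x 0, tail x)) ⁻¹' (Ioo (0 : ℝ) 1 ×ˢ univ) := by
    ext x; simp [slab]
  have hm : Measurable fun q : ℝ × EuclideanSpace ℝ (Fin d) =>
      ENNReal.ofReal (q.1 ^ d) * g q.2 := by fun_prop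
  rw [h1, measurePreserving_cons.setLIntegral_comp_preimage
    (measurableSet_Ioo.prod MeasurableSet.univ) hm]
  rw [Measure.volume_eq_prod, ← Measure.prod_restrict, Measure.restrict_univ]
  exact lintegral_prod_mul (f := fun r : ℝ => ENNReal.ofReal (r ^ d)) (by fun_prop)
    hg.aemeasurable

variable (d) in
/-- The factor `∫₀¹ rᵈ dr`. -/
def radialConst : ℝ≥0∞ := ∫⁻ r in Ioo (0 : ℝ) 1, ENNReal.ofReal (r ^ d)

lemma radialConst_ne_top : radialConst d ≠ ⊤ := by
  refine ne_of_lt (lt_of_le_of_lt (setLIntegral_mono measurable_const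
    (g := fun _ => 1) fun r hr => ?_) ?_)
  · exact ENNReal.ofReal_le_one.2 (pow_le_one₀ hr.1.le hr.2.le)
  · simp

lemma radialConst_ne_zero : radialConst d ≠ 0 := by
  rw [radialConst, ← pos_iff_ne_zero, setLIntegral_pos_iff (by fun_prop)]
  have : Ioo (0 : ℝ) 1 ⊆ Function.support (fun r : ℝ => ENNReal.ofReal (r ^ d)) := by
    intro r hr
    have := pow_pos hr.1 d
    simpa using this
  rw [inter_eq_right.2 this]
  simp

end Finsler

end

/-! ### Two-sided bounds for the fibre energy -/

noncomputable section

namespace Finsler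

variable {d : ℕ}

/-- The function `w ↦ (L(v) / φ(v))²`, where `v = direction s w`. -/
def dirEnergy (φ : Model d → ℝ) (L : Model d →L[ℝ] ℝ) (s : ℤˣ) (w : EuclideanSpace ℝ (Fin d)) :
    ℝ :=
  (L (direction s w) / φ (direction s w)) ^ 2

/-- The integral of `(L(v) / φ(v))²` over the space of directions, for the contact measure. -/
def fibreEnergy (φ : Model d → ℝ) (L : Model d →L[ℝ] ℝ) : ℝ≥0∞ :=
  ∑ s : ℤˣ, ∫⁻ w, ENNReal.ofReal |(polarMatrix φ s w).det| * ENNReal.ofReal (dirEnergy φ L s w)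

lemma fibreEnergy_zero (φ : Model d → ℝ) : fibreEnergy φ 0 = 0 := by
  simp [fibreEnergy, dirEnergy]

/-- The equator `{v₀ = 0}` is a null set. -/
lemma volume_equator : volume {v : Model d | v 0 = 0} = 0 := by
  have h := Measure.addHaar_submodule (volume : Measure (Model d))
    (LinearMap.ker (EuclideanSpace.proj (𝕜 := ℝ) (0 : Fin (d + 1))).toLinearMap) ?_
  · exact h
  · intro h
    have : EuclideanSpace.single (0 : Fin (d + 1)) (1 : ℝ) ∈
        LinearMap.ker (EuclideanSpace.proj (𝕜 := ℝ) (0 : Fin (d + 1))).toLinearMap := by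
      rw [h]; trivial
    simp at this

namespace IsMinkowskiNorm

variable {φ : Model d → ℝ} (hφ : IsMinkowskiNorm φ)

include hφ

lemma continuous_dirEnergy (L : Model d →L[ℝ] ℝ) (s : ℤˣ) : Continuous (dirEnergy φ L s) := by
  have h1 : Continuous (direction (d := d) s) := (contDiff_direction s (n := 0)).continuous
  have h2 : Continuous fun w => φ (direction s w) := by
    rw [continuous_iff_continuousAt]
    intro w
    exact ContinuousAt.comp (hφ.contDiffAt _ (direction_ne_zero s w)).continuousAt h1.continuousAt
  exact ((L.continuous.comp h1).div h2 fun w => (hφ.pos _ (direction_ne_zero s w)).ne').pow 2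

/-- An auxiliary radius turns the integral over directions into one over an open subset of ℝⁿ, where
the change of variables `polarMap` applies. The cost is the factor ∫₀¹ rᵈ dr, which is finite and
nonzero and cancels in the end. -/
lemma lintegral_slab_polarDeriv (L : Model d →L[ℝ] ℝ) (s : ℤˣ) :
    ∫⁻ x in slab d, ENNReal.ofReal |(polarDeriv φ s x).det| *
        ENNReal.ofReal (dirEnergy φ L s (tail x)) =
      radialConst d * ∫⁻ w, ENNReal.ofReal |(polarMatrix φ s w).det| *
        ENNReal.ofReal (dirEnergy φ L s w) := by
  have hm : Measurable fun w => ENNReal.ofReal |(polarMatrix φ s w).det| *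
      ENNReal.ofReal (dirEnergy φ L s w) := by
    have h1 := (hφ.continuous_polarMatrix_det s).measurable
    have h2 := (hφ.continuous_dirEnergy L s).measurable
    exact (ENNReal.measurable_ofReal.comp (continuous_abs.measurable.comp h1)).mul
      (ENNReal.measurable_ofReal.comp h2)
  rw [radialConst, ← lintegral_slab _ hm]
  refine setLIntegral_congr_fun measurableSet_slab fun x hx => ?_
  have h0 : 0 ≤ x 0 ^ d := pow_nonneg hx.1.le d
  simp only
  rw [det_polarDeriv, abs_mul, abs_of_nonneg h0, ENNReal.ofReal_mul h0, mul_assoc]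

/-- The duality bound controls L(v) with constant 1 and -L(v) with constant `c`; the factor `1 +
|c|` covers both. -/
lemma dirEnergy_le {c : ℝ} (hc : ∀ v, φ (-v) ≤ c * φ v) (L : Model d →L[ℝ] ℝ) (s : ℤˣ)
    (w : EuclideanSpace ℝ (Fin d)) :
    dirEnergy φ L s w ≤ ((1 + |c|) * dualNorm φ (covec L)) ^ 2 := by
  have hpos := hφ.pos _ (direction_ne_zero s w)
  have hG := hφ.dualNorm_nonneg (covec L)
  have h1 := hφ.inner_le (covec L) (direction s w)
  have h2 := hφ.neg_inner_le hc (covec L) (direction s w)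
  rw [inner_covec] at h1 h2
  have hcG : c * dualNorm φ (covec L) ≤ |c| * dualNorm φ (covec L) :=
    mul_le_mul_of_nonneg_right (le_abs_self c) hG
  have h3 : 0 ≤ |c| * dualNorm φ (covec L) := mul_nonneg (abs_nonneg c) hG
  refine sq_le_sq' ?_ ?_
  · rw [neg_le, ← neg_div, div_le_iff₀ hpos]
    refine h2.trans (mul_le_mul_of_nonneg_right ?_ hpos.le)
    linarith
  · rw [div_le_iff₀ hpos]
    refine h1.trans (mul_le_mul_of_nonneg_right ?_ hpos.le)
    linarith

lemma polarMap_image_subset (s : ℤˣ) : polarMap φ s '' slab d ⊆ dualBall φ := by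
  rintro _ ⟨x, hx, rfl⟩
  rw [hφ.mem_dualBall_iff, hφ.dualNorm_polarMap s hx.1]
  exact hx.2.le

/-- Bound the integrand by its maximum and change variables. Each of the two half-spheres of
directions yields a subset of the dual ball, whence the factor 2. -/
theorem fibreEnergy_le {c : ℝ} (hc : ∀ v, φ (-v) ≤ c * φ v) (L : Model d →L[ℝ] ℝ) :
    radialConst d * fibreEnergy φ L ≤
      2 * (ENNReal.ofReal (((1 + |c|) * dualNorm φ (covec L)) ^ 2) * volume (dualBall φ)) := by
  have key : ∀ s : ℤˣ, radialConst d * ∫⁻ w, ENNReal.ofReal |(polarMatrix φ s w).det| *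
        ENNReal.ofReal (dirEnergy φ L s w) ≤
      ENNReal.ofReal (((1 + |c|) * dualNorm φ (covec L)) ^ 2) * volume (dualBall φ) := by
    intro s
    rw [← hφ.lintegral_slab_polarDeriv]
    calc _ ≤ ∫⁻ x in slab d, ENNReal.ofReal |(polarDeriv φ s x).det| *
          ENNReal.ofReal (((1 + |c|) * dualNorm φ (covec L)) ^ 2) := by
          refine lintegral_mono fun x => ?_
          gcongr
          exact hφ.dirEnergy_le hc L s _
      _ = (∫⁻ x in slab d, ENNReal.ofReal |(polarDeriv φ s x).det|) *
          ENNReal.ofReal (((1 + |c|) * dualNorm φ (covec L)) ^ 2) :=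
          lintegral_mul_const' _ _ ENNReal.ofReal_ne_top
      _ = volume (polarMap φ s '' slab d) *
          ENNReal.ofReal (((1 + |c|) * dualNorm φ (covec L)) ^ 2) := by
          rw [lintegral_abs_det_fderiv_eq_addHaar_image volume measurableSet_slab
            (fun x _ => (hφ.hasFDerivAt_polarMap s x).hasFDerivWithinAt) (hφ.injOn_polarMap s)]
      _ ≤ _ := by
          rw [mul_comm]
          gcongr
          exact hφ.polarMap_image_subset s
  rw [fibreEnergy, Finset.mul_sum]
  refine (Finset.sum_le_sum fun s _ => key s).trans ?_
  simp

/-- The dual directions of equatorial vectors form a null set. -/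
lemma volume_equator_image :
    volume ((fun v => φ v • covec (fderiv ℝ φ v)) '' {v : Model d | v ≠ 0 ∧ v 0 = 0}) = 0 := by
  refine addHaar_image_eq_zero_of_differentiableOn_of_addHaar_eq_zero volume ?_
    (measure_mono_null (fun v hv => hv.2) volume_equator)
  intro v hv
  have h1 := hφ.differentiableAt hv.1
  have h2 : DifferentiableAt ℝ (fderiv ℝ φ) v :=
    ((hφ.contDiffAt v hv.1).fderiv_right (m := 1) (by norm_cast)).differentiableAt (by simp)
  exact (h1.smul (covec.differentiableAt.comp v h2)).differentiableWithinAt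

/-- Polar coordinates cover the punctured open dual ball, up to a null set. -/
lemma exists_polarMap_eq {ξ : Model d} (h0 : ξ ≠ 0) (h1 : dualNorm φ ξ < 1) :
    (∃ s : ℤˣ, ∃ x ∈ slab d, polarMap φ s x = ξ) ∨
      ξ ∈ (fun v => φ v • covec (fderiv ℝ φ v)) '' {v : Model d | v ≠ 0 ∧ v 0 = 0} := by
  obtain ⟨v, hv1, hv0, hv⟩ := hφ.exists_inner_eq ξ
  have hG := hφ.dualNorm_pos h0
  have hξ := hφ.eq_smul_covec_fderiv hv0 hv1 hv
  by_cases h : v 0 = 0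
  · right
    -- The map φ · dφ is homogeneous of degree one. Scaling the φ-unit vector `v` by the dual norm
    -- of ξ makes its image ξ, not merely a point on the ray of ξ.
    refine ⟨dualNorm φ ξ • v, ⟨smul_ne_zero hG.ne' hv0, by simp [h]⟩, ?_⟩
    simp only
    rw [hφ.homogeneous _ _ hG, hv1, mul_one, hφ.fderiv_smul hv0 hG, ← hξ]
  · left
    obtain ⟨s, t, w, ht, rfl⟩ := exists_eq_smul_direction h
    refine ⟨s, WithLp.toLp 2 (Fin.cons (dualNorm φ ξ) fun k => w k), ⟨by simpa using hG,
      by simpa using h1⟩, ?_⟩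
    have : tail (WithLp.toLp 2 (Fin.cons (dualNorm φ ξ) fun k => w k) : Model d) = w := by
      ext k; simp
    rw [polarMap, this]
    rw [hφ.fderiv_smul (direction_ne_zero s w) ht] at hξ
    exact hξ.symm

/-- A lower bound for the energy by the measure of a set of covectors on which the derivative of
the dual norm in a given direction is bounded below. -/
lemma mul_volume_le_fibreEnergy (L : Model d →L[ℝ] ℝ) {U : Set (Model d)} (hU : MeasurableSet U)
    {m : ℝ} (h0 : 0 ∉ U) (h1 : ∀ ξ ∈ U, dualNorm φ ξ < 1) (hm : 0 ≤ m)
    (hmU : ∀ ξ ∈ U, ∀ v, φ v = 1 → inner ℝ ξ v = dualNorm φ ξ → m ≤ L v) :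
    ENNReal.ofReal (m ^ 2) * volume U ≤ radialConst d * fibreEnergy φ L := by
  set W : ℤˣ → Set (Model d) := fun s => slab d ∩ polarMap φ s ⁻¹' U with hW
  have hcover : U ⊆ (⋃ s : ℤˣ, polarMap φ s '' W s) ∪
      (fun v => φ v • covec (fderiv ℝ φ v)) '' {v : Model d | v ≠ 0 ∧ v 0 = 0} := by
    intro ξ hξ
    rcases hφ.exists_polarMap_eq (fun h => h0 (h ▸ hξ)) (h1 ξ hξ) with ⟨s, x, hx, rfl⟩ | h
    · exact Or.inl (mem_iUnion.2 ⟨s, x, ⟨hx, hξ⟩, rfl⟩)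
    · exact Or.inr h
  have hWm : ∀ s, MeasurableSet (W s) := fun s => by
    have hc : Continuous (polarMap φ s) := continuous_iff_continuousAt.2
      fun x => (hφ.hasFDerivAt_polarMap s x).continuousAt
    exact measurableSet_slab.inter (hc.measurable hU)
  have hvol : volume U ≤ ∑ s : ℤˣ, volume (polarMap φ s '' W s) := by
    refine (measure_mono hcover).trans ((measure_union_le _ _).trans ?_)
    rw [hφ.volume_equator_image, add_zero]
    exact measure_iUnion_fintype_le _ _
  have hs : ∀ s : ℤˣ, ENNReal.ofReal (m ^ 2) * volume (polarMap φ s '' W s) ≤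
      radialConst d * ∫⁻ w, ENNReal.ofReal |(polarMatrix φ s w).det| *
        ENNReal.ofReal (dirEnergy φ L s w) := by
    intro s
    rw [← hφ.lintegral_slab_polarDeriv]
    calc _ ≤ ENNReal.ofReal (m ^ 2) * ∫⁻ x in W s, ENNReal.ofReal |(polarDeriv φ s x).det| := by
          gcongr
          exact addHaar_image_le_lintegral_abs_det_fderiv volume (hWm s)
            (fun x _ => (hφ.hasFDerivAt_polarMap s x).hasFDerivWithinAt)
      _ = ∫⁻ x in W s, ENNReal.ofReal (m ^ 2) * ENNReal.ofReal |(polarDeriv φ s x).det| :=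
          (lintegral_const_mul' _ _ ENNReal.ofReal_ne_top).symm
      _ ≤ ∫⁻ x in W s, ENNReal.ofReal |(polarDeriv φ s x).det| *
            ENNReal.ofReal (dirEnergy φ L s (tail x)) := by
          refine setLIntegral_mono' (hWm s) fun x hx => ?_
          rw [mul_comm]
          gcongr
          have hv0 := direction_ne_zero s (tail x)
          have hpos := hφ.pos _ hv0
          -- The φ-unit vector in the direction with coordinates `tail x` realizes the dual norm of
          -- `polarMap φ s x`, so the lower bound on `U` applies to it.
          have := hmU _ hx.2 ((φ (direction s (tail x)))⁻¹ • direction s (tail x)) ?_ ?_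
          · rw [map_smul, smul_eq_mul, ← div_eq_inv_mul] at this
            exact pow_le_pow_left₀ hm this 2
          · rw [hφ.homogeneous _ _ (inv_pos.2 hpos), inv_mul_cancel₀ hpos.ne']
          · rw [hφ.dualNorm_polarMap s hx.1.1, polarMap, inner_smul_right, real_inner_smul_left,
              inner_covec, hφ.fderiv_self hv0]
            field_simp
      _ ≤ _ := lintegral_mono_set inter_subset_left
  calc _ ≤ ENNReal.ofReal (m ^ 2) * ∑ s : ℤˣ, volume (polarMap φ s '' W s) := by gcongr
    _ = ∑ s : ℤˣ, ENNReal.ofReal (m ^ 2) * volume (polarMap φ s '' W s) := Finset.mul_sum _ _ _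
    _ ≤ _ := by
      rw [fibreEnergy, Finset.mul_sum]
      exact Finset.sum_le_sum fun s _ => hs s

/-- Let η be the multiple of L of dual norm 1/2 and take `U` = η + ε B*. If ξ ∈ `U` attains its dual
norm at the φ-unit vector v, then η(v) ≥ φ*(ξ) - ε ≥ 1/4, that is, L(v) ≥ φ*(L)/2. The volume of `U`
is εⁿ vol(B*). -/
theorem le_fibreEnergy {c : ℝ} (hc : ∀ v, φ (-v) ≤ c * φ v) (L : Model d →L[ℝ] ℝ) (hL : L ≠ 0) :
    ENNReal.ofReal ((dualNorm φ (covec L) / 2) ^ 2) *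
        (ENNReal.ofReal ((1 / (4 * (1 + |c|))) ^ (d + 1)) * volume (dualBall φ)) ≤
      radialConst d * fibreEnergy φ L := by
  have hη : covec L ≠ 0 := fun h => hL (covec_injective (by rw [h, _root_.map_zero]))
  have hG := hφ.dualNorm_pos hη
  set G := dualNorm φ (covec L) with hGdef
  set η := (2 * G)⁻¹ • covec L with hηdef
  -- Chosen so that |c| ε = 1/4 - ε. Since φ*(η - ξ) ≤ |c| ε, this gives φ*(ξ) ≥ 1/2 - |c| ε = 1/4 +
  -- ε, while φ*(ξ) ≤ 1/2 + ε < 1.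
  set ε : ℝ := 1 / (4 * (1 + |c|)) with hε
  have hc1 : 0 < 1 + |c| := by positivity
  have hε0 : 0 < ε := by positivity
  have hε1 : ε * (1 + |c|) = 1 / 4 := by rw [hε]; field_simp
  have hGη : dualNorm φ η = 1 / 2 := by
    rw [hηdef, hφ.dualNorm_smul _ (by positivity), ← hGdef]; field_simp
  set U : Set (Model d) := (fun ξ => ξ - η) ⁻¹' ((fun ζ => ε⁻¹ • ζ) ⁻¹' dualBall φ) with hU
  have hUvol : volume U = ENNReal.ofReal (ε ^ (d + 1)) * volume (dualBall φ) := by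
    have h1 : volume U = volume ((fun ζ => ε⁻¹ • ζ) ⁻¹' dualBall φ) := by
      rw [hU]
      simp_rw [sub_eq_add_neg]
      exact measure_preimage_add_right volume (-η) _
    rw [h1, Measure.addHaar_preimage_smul volume (inv_ne_zero hε0.ne')]
    simp [abs_of_pos hε0]
  have hUm : MeasurableSet U :=
    (((isClosed_dualBall φ).preimage (by fun_prop : Continuous fun ζ : Model d => ε⁻¹ • ζ)).preimage
      (by fun_prop : Continuous fun ξ : Model d => ξ - η)).measurableSet
  have hζ : ∀ ξ ∈ U, dualNorm φ (ξ - η) ≤ ε := by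
    intro ξ hξ
    have : dualNorm φ (ε⁻¹ • (ξ - η)) ≤ 1 := hφ.mem_dualBall_iff.1 hξ
    rw [hφ.dualNorm_smul _ (inv_pos.2 hε0), inv_mul_le_iff₀ hε0, mul_one] at this
    exact this
  have hcε : |c| * ε = 1 / 4 - ε := by linarith
  have hεle : ε ≤ 1 / 4 := by nlinarith [mul_nonneg hε0.le (abs_nonneg c)]
  have hlow : ∀ ξ ∈ U, 1 / 4 + ε ≤ dualNorm φ ξ := by
    intro ξ hξ
    have h1 := hφ.dualNorm_add_le ξ (-(ξ - η))
    have h2 := hφ.dualNorm_neg_le hc (ξ - η)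
    have h3 : c * dualNorm φ (ξ - η) ≤ |c| * ε :=
      mul_le_mul (le_abs_self c) (hζ ξ hξ) (hφ.dualNorm_nonneg _) (abs_nonneg c)
    have h4 : ξ + -(ξ - η) = η := by abel
    rw [h4, hGη] at h1
    linarith
  rw [← hUvol]
  refine hφ.mul_volume_le_fibreEnergy L hUm ?_ ?_ (by positivity) ?_
  · intro h
    have h1 := hlow 0 h
    obtain ⟨v, -, -, h2⟩ := hφ.exists_inner_eq 0
    rw [inner_zero_left] at h2
    linarith
  · intro ξ hξ
    have h1 := hφ.dualNorm_add_le η (ξ - η)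
    rw [add_sub_cancel, hGη] at h1
    linarith [hζ ξ hξ]
  · intro ξ hξ v hv1 hv
    have h1 := hφ.inner_le (ξ - η) v
    rw [hv1, mul_one, inner_sub_left, hv] at h1
    have h2 : (1 : ℝ) / 4 ≤ inner ℝ η v := by linarith [hlow ξ hξ, hζ ξ hξ]
    rw [hηdef, real_inner_smul_left, inner_covec, le_inv_mul_iff₀ (by positivity)] at h2
    linarith

end IsMinkowskiNorm

/-- The constant of the comparison of fibre energies. -/
def compConst (d : ℕ) (C c c₀ : ℝ) : ℝ :=
  2 * ((1 + |c|) * C) ^ 2 * C ^ (d + 1) * (4 * (4 * (1 + |c₀|)) ^ (d + 1))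

/-- The fibre energies of two bi-Lipschitz Minkowski norms are comparable. -/
theorem fibreEnergy_le_compConst_mul {φ φ₀ : Model d → ℝ} (hφ : IsMinkowskiNorm φ)
    (hφ₀ : IsMinkowskiNorm φ₀) {C c c₀ : ℝ} (hC : 0 < C)
    (hc : ∀ v, φ (-v) ≤ c * φ v) (hc₀ : ∀ v, φ₀ (-v) ≤ c₀ * φ₀ v)
    (h1 : ∀ v, φ v ≤ C * φ₀ v) (h2 : ∀ v, φ₀ v ≤ C * φ v) (L : Model d →L[ℝ] ℝ) :
    fibreEnergy φ L ≤ ENNReal.ofReal (compConst d C c c₀) * fibreEnergy φ₀ L := by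
  by_cases hL : L = 0
  · simp [hL, fibreEnergy_zero]
  have hη : covec L ≠ 0 := fun h => hL (covec_injective (by rw [h, map_zero]))
  have hG₀ := hφ₀.dualNorm_pos hη
  have hG : dualNorm φ (covec L) ≤ C * dualNorm φ₀ (covec L) := hφ.dualNorm_le fun v =>
    calc inner ℝ (covec L) v ≤ dualNorm φ₀ (covec L) * φ₀ v := hφ₀.inner_le _ v
      _ ≤ dualNorm φ₀ (covec L) * (C * φ v) := mul_le_mul_of_nonneg_left (h2 v) hG₀.le
      _ = _ := by ring
  -- φ ≤ C φ₀ places the dual ball of φ inside `C` times that of φ₀.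
  have hB : volume (dualBall φ) ≤ ENNReal.ofReal (C ^ (d + 1)) * volume (dualBall φ₀) := by
    have hsub : dualBall φ ⊆ (fun ζ => C⁻¹ • ζ) ⁻¹' dualBall φ₀ := by
      intro ξ hξ v
      rw [real_inner_smul_left, inv_mul_le_iff₀ hC]
      exact (hξ v).trans (h1 v)
    refine (measure_mono hsub).trans ?_
    rw [Measure.addHaar_preimage_smul volume (inv_ne_zero hC.ne')]
    simp [abs_of_pos hC]
  have hup := hφ.fibreEnergy_le hc L
  have hlow := hφ₀.le_fibreEnergy hc₀ L hL
  set G₀ := dualNorm φ₀ (covec L) with hG₀def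
  set ε : ℝ := (1 / (4 * (1 + |c₀|))) ^ (d + 1) with hε
  have hc1 : 0 < 1 + |c₀| := by positivity
  have hε0 : 0 < ε := by positivity
  -- `compConst` is the coefficient of the upper bound for φ divided by that of the lower bound for
  -- φ₀; G₀² cancels.
  have hconst : 2 * ((1 + |c|) * (C * G₀)) ^ 2 * C ^ (d + 1) =
      compConst d C c c₀ * ((G₀ / 2) ^ 2 * ε) := by
    have : (4 * (1 + |c₀|)) ^ (d + 1) * ε = 1 := by
      rw [hε, ← mul_pow]
      rw [mul_one_div_cancel (by positivity), one_pow]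
    rw [compConst]
    linear_combination (-2 * ((1 + |c|) * (C * G₀)) ^ 2 * C ^ (d + 1)) * this
  have hcc : 0 ≤ compConst d C c c₀ := by rw [compConst]; positivity
  have key : radialConst d * fibreEnergy φ L ≤
      radialConst d * (ENNReal.ofReal (compConst d C c c₀) * fibreEnergy φ₀ L) := by
    calc _ ≤ 2 * (ENNReal.ofReal (((1 + |c|) * dualNorm φ (covec L)) ^ 2) *
          volume (dualBall φ)) := hup
      _ ≤ 2 * (ENNReal.ofReal (((1 + |c|) * (C * G₀)) ^ 2) *
          (ENNReal.ofReal (C ^ (d + 1)) * volume (dualBall φ₀))) := by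
          gcongr
          exact mul_nonneg (by positivity) (hφ.dualNorm_nonneg _)
      _ = ENNReal.ofReal (2 * ((1 + |c|) * (C * G₀)) ^ 2 * C ^ (d + 1)) *
          volume (dualBall φ₀) := by
          rw [ENNReal.ofReal_mul (by positivity), ENNReal.ofReal_mul (by positivity),
            ENNReal.ofReal_ofNat]
          ring
      _ = ENNReal.ofReal (compConst d C c c₀) * (ENNReal.ofReal ((G₀ / 2) ^ 2) *
          (ENNReal.ofReal ε * volume (dualBall φ₀))) := by
          rw [hconst, ENNReal.ofReal_mul hcc, ENNReal.ofReal_mul (by positivity)]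
          ring
      _ ≤ ENNReal.ofReal (compConst d C c c₀) * (radialConst d * fibreEnergy φ₀ L) := by gcongr
      _ = _ := by ring
  exact (ENNReal.mul_le_mul_iff_right radialConst_ne_zero radialConst_ne_top).1 key

end Finsler

end

/-! ### Finsler metrics in charts -/

noncomputable section

namespace Finsler

variable {d : ℕ} {M : Type*} [TopologicalSpace M] [ChartedSpace (Model d) M]
  [IsManifold 𝓘(ℝ, Model d) ∞ M]

/-- In a chart, the metric on a tangent space is the metric of `M` up to a linear isomorphism. -/
lemma exists_inChart_eq {e : OpenPartialHomeomorph M (Model d)}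
    (he : e ∈ atlas (Model d) M) {y : Model d} (hy : y ∈ e.target) :
    ∃ T : Model d ≃L[ℝ] Model d,
      (∀ v : Model d, (tangentMap 𝓘(ℝ, Model d) 𝓘(ℝ, Model d) e.symm ⟨y, v⟩).2 = T v) ∧
      ∀ (F : FinslerMetric d M) (v : Model d), F.inChart e y v = F.toFun ⟨e.symm y, T v⟩ := by
  have : IsManifold 𝓘(ℝ, Model d) 1 M := IsManifold.of_le (n := ∞) (by simp)
  have h := (mdifferentiable_of_mem_atlas (I := 𝓘(ℝ, Model d)) he).symm
  exact ⟨h.mfderiv hy, fun _ => rfl, fun _ _ => rfl⟩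

/-- In a chart, a Finsler metric is smooth off the zero section. -/
lemma FinslerMetric.contDiffOn_inChart (F : FinslerMetric d M)
    {e : OpenPartialHomeomorph M (Model d)} (he : e ∈ atlas (Model d) M) :
    ContDiffOn ℝ ∞ (fun q : Model d × Model d => F.inChart e q.1 q.2)
      (e.target ×ˢ {v | v ≠ 0}) := by
  have : IsManifold 𝓘(ℝ, Model d) 1 M := IsManifold.of_le (n := ∞) (by simp)
  have h1 : ContMDiffOn 𝓘(ℝ, Model d) 𝓘(ℝ, Model d) ∞ e.symm e.target :=
    contMDiffOn_symm_of_mem_maximalAtlas (IsManifold.subset_maximalAtlas he)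
  have h2 := h1.contMDiffOn_tangentMapWithin (m := ∞) (by simp) e.open_target.uniqueMDiffOn
  have h3 : ContMDiffOn 𝓘(ℝ, Model d).tangent 𝓘(ℝ, Model d).tangent ∞
      (tangentMap 𝓘(ℝ, Model d) 𝓘(ℝ, Model d) e.symm)
      (Bundle.TotalSpace.proj ⁻¹' e.target) := by
    refine h2.congr fun p hp => ?_
    rw [tangentMapWithin_eq_tangentMap (e.open_target.uniqueMDiffWithinAt hp)]
    exact (h1.mdifferentiableOn (by simp)).mdifferentiableAt (e.open_target.mem_nhds hp)
  have h4 : ContMDiffOn 𝓘(ℝ, Model d).tangent 𝓘(ℝ, Model d).tangent ∞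
      (fun q : ModelProd (Model d) (Model d) => tangentMap 𝓘(ℝ, Model d) 𝓘(ℝ, Model d) e.symm
        ((tangentBundleModelSpaceHomeomorph 𝓘(ℝ, Model d)).symm q)) (e.target ×ˢ {v | v ≠ 0}) :=
    h3.comp contMDiff_tangentBundleModelSpaceHomeomorph_symm.contMDiffOn fun q hq => hq.1
  have h5 := F.smooth.comp h4 (fun q hq => by
    obtain ⟨T, hT, -⟩ := exists_inChart_eq he hq.1
    intro h0
    have h0 : T q.2 = 0 := (hT q.2).symm.trans h0
    exact hq.2 (by simpa using h0))
  have h6 : ContMDiffOn 𝓘(ℝ, Model d × Model d) 𝓘(ℝ, ℝ) ∞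
      (fun q : Model d × Model d => F.inChart e q.1 q.2) (e.target ×ˢ {v | v ≠ 0}) := by
    rw [modelWithCornersSelf_prod]
    exact h5
  exact h6.contDiffOn

/-- The Hessian of a function composed with a linear isomorphism. -/
lemma fderiv_fderiv_comp_equiv {E : Type*} [NormedAddCommGroup E] [NormedSpace ℝ E]
    (T : E ≃L[ℝ] E) (g : E → ℝ) {v : E}
    (hg : DifferentiableAt ℝ (fderiv ℝ g) (T v)) (u : E) :
    fderiv ℝ (fderiv ℝ (fun w => g (T w))) v u u = fderiv ℝ (fderiv ℝ g) (T v) (T u) (T u) := by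
  have h1 : fderiv ℝ (fun w => g (T w)) = fun w =>
      (ContinuousLinearMap.compL ℝ E E ℝ).flip (T : E →L[ℝ] E) (fderiv ℝ g (T w)) := by
    funext w
    exact T.comp_right_fderiv
  have h2 := ((ContinuousLinearMap.compL ℝ E E ℝ).flip (T : E →L[ℝ] E)).hasFDerivAt.comp v
    (hg.hasFDerivAt.comp v T.hasFDerivAt)
  rw [h1]
  have h3 := h2.fderiv
  rw [show (fun w => (ContinuousLinearMap.compL ℝ E E ℝ).flip (T : E →L[ℝ] E) (fderiv ℝ g (T w))) =
    ((ContinuousLinearMap.compL ℝ E E ℝ).flip (T : E →L[ℝ] E)) ∘ (fderiv ℝ g ∘ T) from rfl, h3]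
  rfl

namespace FinslerMetric

variable (F : FinslerMetric d M) {e : OpenPartialHomeomorph M (Model d)}

lemma contDiffAt_inChart (he : e ∈ atlas (Model d) M) {y v : Model d} (hy : y ∈ e.target)
    (hv : v ≠ 0) : ContDiffAt ℝ ∞ (fun q : Model d × Model d => F.inChart e q.1 q.2) (y, v) :=
  (F.contDiffOn_inChart he).contDiffAt
    ((e.open_target.prod isOpen_ne).mem_nhds ⟨hy, hv⟩)

/-- In a chart, a Finsler metric is a Minkowski norm on each tangent space. -/
theorem isMinkowskiNorm_inChart (he : e ∈ atlas (Model d) M) {y : Model d} (hy : y ∈ e.target) :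
    IsMinkowskiNorm (F.inChart e y) := by
  obtain ⟨T, -, hT⟩ := exists_inChart_eq he hy
  have hTF := hT F
  have hsm : ∀ v, v ≠ 0 → ContDiffAt ℝ ∞ (F.inChart e y) v := fun v hv =>
    ContDiffAt.comp (g := fun q : Model d × Model d => F.inChart e q.1 q.2) v
      (F.contDiffAt_inChart he hy hv)
      (contDiffAt_const.prodMk contDiffAt_id)
  have hTne : ∀ v, v ≠ 0 → T v ≠ 0 := fun v hv => by simpa using hv
  refine ⟨hsm, ?_, ?_, ?_, ?_⟩
  · rw [hTF, _root_.map_zero]; exact (F.eq_zero_iff _ _).2 rfl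
  · intro v hv
    rw [hTF]
    exact lt_of_le_of_ne (F.nonneg _) fun h => hTne v hv ((F.eq_zero_iff _ _).1 h.symm)
  · intro v t ht
    rw [hTF, hTF, map_smul]
    exact F.homogeneous _ _ t ht
  · intro v u hv hu
    set g : Model d → ℝ := fun w => F.toFun ⟨e.symm y, w⟩ ^ 2 with hg
    have hgT : (fun w => F.inChart e y w ^ 2) = fun w => g (T w) := by
      funext w; rw [hTF]
    -- Smoothness of `F` is given on the tangent bundle; on a single tangent space it is read off in
    -- the chart and carried back by `T.symm`.
    have hgs : ContDiffAt ℝ ∞ g (T v) := by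
      have h1 : g = (fun w => F.inChart e y w ^ 2) ∘ T.symm := by
        rw [hgT]; funext w; simp
      rw [h1]
      refine ContDiffAt.comp (T v) ?_ T.symm.contDiff.contDiffAt
      simpa using (hsm v hv).pow 2
    have hgd : DifferentiableAt ℝ (fderiv ℝ g) (T v) :=
      (hgs.fderiv_right (m := 1) (by norm_cast)).differentiableAt (by simp)
    rw [hgT, fderiv_fderiv_comp_equiv T g hgd]
    exact F.strongly_convex _ _ _ (hTne v hv) (hTne u hu)

/-- The supremum only concerns unit vectors; homogeneity extends the bound to all vectors. -/
lemma inChart_neg_le (he : e ∈ atlas (Model d) M) {y : Model d} (hy : y ∈ e.target) {c : ℝ}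
    (hc : F.IsQuasireversibilityConstant c) (v : Model d) :
    F.inChart e y (-v) ≤ c * F.inChart e y v := by
  obtain ⟨T, -, hT⟩ := exists_inChart_eq he hy
  have hTF := hT F
  have hm := F.isMinkowskiNorm_inChart he hy
  by_cases hv : v = 0
  · simp [hv, hm.map_zero]
  have hpos := hm.pos v hv
  set t := (F.inChart e y v)⁻¹ with ht
  have ht0 : 0 < t := inv_pos.2 hpos
  have h1 : F.inChart e y (t • v) = 1 := by
    rw [hm.homogeneous _ _ ht0, ht, inv_mul_cancel₀ hpos.ne']
  have h2 : F.inChart e y (-(t • v)) ≤ c := by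
    refine hc.1 ⟨e.symm y, T (t • v), ?_, ?_⟩
    · rw [← h1, hTF]
    · rw [hTF, map_neg]
      rfl
  rw [← smul_neg, hm.homogeneous _ _ ht0, ht, inv_mul_le_iff₀ hpos] at h2
  linarith

lemma BiLipschitz.inChart_le {F F₀ : FinslerMetric d M} {C : ℝ} (h : F.BiLipschitz F₀ C)
    (hC : 0 < C) (he : e ∈ atlas (Model d) M) {y : Model d} (hy : y ∈ e.target) (v : Model d) :
    F.inChart e y v ≤ C * F₀.inChart e y v ∧ F₀.inChart e y v ≤ C * F.inChart e y v := by
  obtain ⟨T, -, hTF⟩ := exists_inChart_eq he hy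
  have hm := F.isMinkowskiNorm_inChart he hy
  have hm₀ := F₀.isMinkowskiNorm_inChart he hy
  by_cases hv : v = 0
  · simp [hv, hm.map_zero, hm₀.map_zero]
  have hpos := hm₀.pos v hv
  have hTv : T v ≠ 0 := by simpa using hv
  have h1 := h (e.symm y) (T v) hTv
  rw [← hTF F v, ← hTF F₀ v, div_le_iff₀ hpos, le_div_iff₀ hpos, inv_mul_le_iff₀ hC] at h1
  exact ⟨h1.2, h1.1⟩

end FinslerMetric

end Finsler

end

/-! ### The contact density and the Reeb field of the Hilbert form -/

noncomputable section

namespace Finsler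

variable {d : ℕ}

lemma dOneForm_apply {V : Type*} [NormedAddCommGroup V] [NormedSpace ℝ V] {A : V → V →L[ℝ] ℝ}
    {p : V} (hA : DifferentiableAt ℝ A p) (X Z : V) :
    dOneForm A p ![X, Z] = fderiv ℝ A p X Z - fderiv ℝ A p Z X := by
  have h1 : DifferentiableAt ℝ (oneForm A) p :=
    (ContinuousAlternatingMap.ofSubsingletonLIE (𝕜 := ℝ) (E := V) (F := ℝ)
      (0 : Fin 1)).differentiableAt.comp p hA
  have h2 : ∀ Y W : V, fderiv ℝ (fun x => A x W) p Y = fderiv ℝ A p Y W := by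
    intro Y W
    have := (hA.hasFDerivAt.clm_apply (hasFDerivAt_const W p)).fderiv
    rw [this]
    simp
  rw [dOneForm, extDeriv_apply h1, Fin.sum_univ_two]
  have h3 : (fun x => oneForm A x ((0 : Fin 2).removeNth ![X, Z])) = fun x => A x Z := by
    funext x; simp [oneForm]
  have h4 : (fun x => oneForm A x ((1 : Fin 2).removeNth ![X, Z])) = fun x => A x X := by
    funext x; simp [oneForm, Fin.removeNth]
  rw [h3, h4]
  simp only [Fin.val_zero, pow_zero, one_smul, Fin.val_one, pow_one, Matrix.cons_val_zero,
    Matrix.cons_val_one, h2, neg_smul]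
  ring

namespace IsMinkowskiNorm

variable {φ : Model d → ℝ} (hφ : IsMinkowskiNorm φ)

include hφ

/-- Differentiate Euler's identity p(w)(v(w)) = φ(v(w)) in w: the term p(w)(dv) appears on both
sides and cancels. -/
lemma fderiv_fderiv_direction_self (s : ℤˣ) (w z : EuclideanSpace ℝ (Fin d)) :
    fderiv ℝ (fun w => fderiv ℝ φ (direction s w)) w z (direction s w) = 0 := by
  have h1 := ((hφ.contDiff_fderiv_direction s).differentiable (by simp) w).hasFDerivAt
  have h2 := h1.clm_apply (hasFDerivAt_direction s w)
  have h3 := (hφ.differentiableAt (direction_ne_zero s w)).hasFDerivAt.comp w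
    (hasFDerivAt_direction s w)
  have h4 : (fun w => fderiv ℝ φ (direction s w) (direction s w)) = φ ∘ direction s :=
    funext fun w => hφ.fderiv_self (direction_ne_zero s w)
  rw [h4] at h2
  have h5 := congrArg (fun L : EuclideanSpace ℝ (Fin d) →L[ℝ] ℝ => L z) (h2.unique h3)
  simpa using h5

end IsMinkowskiNorm

/-- Vectors are determined by their pairings with the columns of an invertible `polarMatrix`. -/
lemma eq_of_polarMatrix {φ : Model d → ℝ} {s : ℤˣ} {w : EuclideanSpace ℝ (Fin d)}
    (hdet : (polarMatrix φ s w).det ≠ 0) {u v : Model d}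
    (h0 : fderiv ℝ φ (direction s w) u = fderiv ℝ φ (direction s w) v)
    (h1 : ∀ k, fderiv ℝ (fun w => fderiv ℝ φ (direction s w)) w (EuclideanSpace.single k 1) u =
      fderiv ℝ (fun w => fderiv ℝ φ (direction s w)) w (EuclideanSpace.single k 1) v) : u = v := by
  have key : ∀ x : Model d, Matrix.vecMul (fun i => x i) (polarMatrix φ s w) =
      Fin.cons (fderiv ℝ φ (direction s w) x) (fun k =>
        fderiv ℝ (fun w => fderiv ℝ φ (direction s w)) w (EuclideanSpace.single k 1) x) := by
    intro x
    funext j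
    refine Fin.cases ?_ (fun k => ?_) j
    · rw [Fin.cons_zero, ← inner_covec]
      simp [Matrix.vecMul, dotProduct, polarMatrix, PiLp.inner_apply, covec_apply]
    · rw [Fin.cons_succ, ← inner_covec]
      simp [Matrix.vecMul, dotProduct, polarMatrix, PiLp.inner_apply, covec_apply]
  have h : Matrix.vecMul (fun i => u i) (polarMatrix φ s w) =
      Matrix.vecMul (fun i => v i) (polarMatrix φ s w) := by
    rw [key, key, h0]
    congr 1
    funext k
    exact h1 k
  have := Matrix.vecMul_injective_of_isUnit
    ((Matrix.isUnit_iff_isUnit_det _).2 (isUnit_iff_ne_zero.2 hdet)) h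
  ext i
  exact congrFun this i

/-- Covectors are combinations of the columns of an invertible `polarMatrix`. -/
lemma exists_polarMatrix_eq {φ : Model d → ℝ} {s : ℤˣ} {w : EuclideanSpace ℝ (Fin d)}
    (hdet : (polarMatrix φ s w).det ≠ 0) (β : Model d →L[ℝ] ℝ) :
    ∃ (c : ℝ) (z : EuclideanSpace ℝ (Fin d)), ∀ u, β u = c * fderiv ℝ φ (direction s w) u +
      fderiv ℝ (fun w => fderiv ℝ φ (direction s w)) w z u := by
  obtain ⟨x, hx⟩ := Matrix.mulVec_surjective_iff_isUnit.2
    ((Matrix.isUnit_iff_isUnit_det _).2 (isUnit_iff_ne_zero.2 hdet)) (fun i => covec β i)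
  refine ⟨x 0, WithLp.toLp 2 fun k => x k.succ, fun u => ?_⟩
  have hz : (WithLp.toLp 2 fun k => x k.succ : EuclideanSpace ℝ (Fin d)) =
      ∑ k, x k.succ • EuclideanSpace.single k (1 : ℝ) := by
    ext j; simp [Pi.single_apply]
  have : β = x 0 • fderiv ℝ φ (direction s w) +
      fderiv ℝ (fun w => fderiv ℝ φ (direction s w)) w (WithLp.toLp 2 fun k => x k.succ) := by
    apply covec_injective
    ext i
    have h := congrFun hx i
    rw [← h, hz]
    simp [Matrix.mulVec, dotProduct, polarMatrix, Fin.sum_univ_succ, covec_apply, mul_comm]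
  exact congrArg (fun L : Model d →L[ℝ] ℝ => L u) this

variable {M : Type*} [TopologicalSpace M] [ChartedSpace (Model d) M]
  [IsManifold 𝓘(ℝ, Model d) ∞ M]

namespace FinslerMetric

variable (F : FinslerMetric d M) {e : OpenPartialHomeomorph M (Model d)}

/-- The momentum `∂F/∂v` in coordinates. -/
def momentum (e : OpenPartialHomeomorph M (Model d)) (s : ℤˣ) (p : HCoord d) :
    Model d →L[ℝ] ℝ :=
  fderiv ℝ (F.inChart e p.1) (direction s p.2)

lemma contDiffAt_momentum (he : e ∈ atlas (Model d) M) (s : ℤˣ) {p : HCoord d}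
    (hp : p.1 ∈ e.target) : ContDiffAt ℝ ∞ (F.momentum e s) p := by
  have h1 : ContDiffAt ℝ ∞ (Function.uncurry fun q : HCoord d => F.inChart e q.1)
      (p, direction s p.2) := by
    have h2 := F.contDiffAt_inChart he hp (direction_ne_zero s p.2)
    have h3 : ContDiffAt ℝ ∞ (fun q : HCoord d × Model d => (q.1.1, q.2)) (p, direction s p.2) :=
      (contDiffAt_fst.fst).prodMk contDiffAt_snd
    exact ContDiffAt.comp (g := fun q : Model d × Model d => F.inChart e q.1 q.2)
      (f := fun q : HCoord d × Model d => (q.1.1, q.2)) (p, direction s p.2) h2 h3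
  exact h1.fderiv (m := ∞) ((contDiff_direction s).contDiffAt.comp p contDiffAt_snd) (by simp)

lemma differentiableAt_momentum (he : e ∈ atlas (Model d) M) (s : ℤˣ) {p : HCoord d}
    (hp : p.1 ∈ e.target) : DifferentiableAt ℝ (F.momentum e s) p :=
  (F.contDiffAt_momentum he s hp).differentiableAt (by simp)

lemma hilbertForm_apply (s : ℤˣ) (p Z : HCoord d) :
    F.hilbertForm e s p Z = fderiv ℝ (F.inChart e p.1) (direction s p.2) Z.1 := rfl

lemma differentiableAt_hilbertForm (he : e ∈ atlas (Model d) M) (s : ℤˣ) {p : HCoord d}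
    (hp : p.1 ∈ e.target) :
    DifferentiableAt ℝ (F.hilbertForm e s) p ∧ ∀ X Z, fderiv ℝ (F.hilbertForm e s) p X Z =
      fderiv ℝ (F.momentum e s) p X Z.1 := by
  set T := (ContinuousLinearMap.compL ℝ (HCoord d) (Model d) ℝ).flip
    (ContinuousLinearMap.fst ℝ (Model d) (EuclideanSpace ℝ (Fin d))) with hT
  have h2 : HasFDerivAt (F.hilbertForm e s) (T ∘L fderiv ℝ (F.momentum e s) p) p :=
    T.hasFDerivAt.comp p (F.differentiableAt_momentum he s hp).hasFDerivAt
  refine ⟨h2.differentiableAt, fun X Z => ?_⟩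
  rw [h2.fderiv]
  rfl

lemma fderiv_momentum_fibre (he : e ∈ atlas (Model d) M) (s : ℤˣ) {p : HCoord d}
    (hp : p.1 ∈ e.target) (z : EuclideanSpace ℝ (Fin d)) :
    fderiv ℝ (F.momentum e s) p (0, z) =
      fderiv ℝ (fun w => fderiv ℝ (F.inChart e p.1) (direction s w)) p.2 z := by
  have h1 : HasFDerivAt (F.momentum e s) (fderiv ℝ (F.momentum e s) p) (p.1, p.2) :=
    (F.differentiableAt_momentum he s hp).hasFDerivAt
  have h2 : HasFDerivAt (fun w => fderiv ℝ (F.inChart e p.1) (direction s w)) _ p.2 :=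
    h1.comp p.2 (hasFDerivAt_prodMk_right p.1 p.2)
  rw [h2.fderiv]
  simp

/-- The Hilbert form sees only base components, so `dA` vanishes on two fibre vectors, and its mixed
values are fibre derivatives of the momentum up to sign. -/
lemma dOneForm_hilbertForm (he : e ∈ atlas (Model d) M) (s : ℤˣ) {p : HCoord d}
    (hp : p.1 ∈ e.target) (X Z : HCoord d) :
    dOneForm (F.hilbertForm e s) p ![X, Z] =
      fderiv ℝ (F.momentum e s) p X Z.1 - fderiv ℝ (F.momentum e s) p Z X.1 := by
  obtain ⟨h1, h2⟩ := F.differentiableAt_hilbertForm he s hp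
  rw [dOneForm_apply h1, h2, h2]

/-- The density of `A ∧ dAⁿ⁻¹` is a universal multiple of the Jacobian of polar coordinates on the
dual space. -/
theorem contactDensity_eq (he : e ∈ atlas (Model d) M) (s : ℤˣ) {p : HCoord d}
    (hp : p.1 ∈ e.target) : F.contactDensity e s p =
      |wedgeConst d| * |(polarMatrix (F.inChart e p.1) s p.2).det| := by
  rw [contactDensity, wedgePow_coordFrame, abs_mul]
  · congr 1
    -- The order base, fibre in `dA` gives each angular column a factor -1, which disappears in the
    -- absolute value.
    have h : (Matrix.of fun i : Fin (d + 1) => (Fin.cons (F.hilbertForm e s p (baseVec i))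
        (fun k : Fin d => dOneForm (F.hilbertForm e s) p ![baseVec i, fibreVec k]) :
          Fin (d + 1) → ℝ)) = Matrix.of fun i j =>
        (Fin.cons 1 (fun _ => -1) : Fin (d + 1) → ℝ) j *
          polarMatrix (F.inChart e p.1) s p.2 i j := by
      ext i j
      refine Fin.cases ?_ (fun k => ?_) j
      · simp [polarMatrix, hilbertForm_apply]
      · simp [polarMatrix, F.dOneForm_hilbertForm he s hp, F.fderiv_momentum_fibre he s hp]
    rw [h, Matrix.det_mul_row, abs_mul, Fin.prod_univ_succ]
    simp
  · intro k
    simp [hilbertForm_apply]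
  · intro k l
    simp [F.dOneForm_hilbertForm he s hp]

/-- The Reeb field projects to the unit vector in the given direction. -/
theorem reeb_fst (he : e ∈ atlas (Model d) M) (s : ℤˣ) {p : HCoord d} (hp : p.1 ∈ e.target)
    (hdet : (polarMatrix (F.inChart e p.1) s p.2).det ≠ 0) :
    (reeb (F.hilbertForm e s) p).1 =
      (F.inChart e p.1 (direction s p.2))⁻¹ • direction s p.2 := by
  have hm := F.isMinkowskiNorm_inChart he hp
  have hv0 := direction_ne_zero s p.2
  have hpos := hm.pos _ hv0
  set φ := F.inChart e p.1 with hφ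
  set v := direction s p.2 with hv
  set V := (φ v)⁻¹ • v with hV
  have hV1 : fderiv ℝ φ v V = 1 := by
    rw [hV, map_smul, hm.fderiv_self hv0, smul_eq_mul, inv_mul_cancel₀ hpos.ne']
  have hV2 : ∀ z, fderiv ℝ (fun w => fderiv ℝ φ (direction s w)) p.2 z V = 0 := by
    intro z
    rw [hV, map_smul, hm.fderiv_fderiv_direction_self, smul_zero]
  -- `reeb` is a choice, so a Reeb vector must first be exhibited. With base part `V`, its fibre
  -- part `z` has to satisfy ∂_z p = β, where β(u) = dA((u, 0), (V, 0)).
  have hex : ∃ X, IsReebAt (F.hilbertForm e s) p X := by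
    set β : Model d →L[ℝ] ℝ :=
      (fderiv ℝ (F.momentum e s) p).flip V ∘L ContinuousLinearMap.inl ℝ _ _ -
        fderiv ℝ (F.momentum e s) p (V, 0) with hβ
    have hβ' : ∀ u, β u = fderiv ℝ (F.momentum e s) p (u, 0) V -
        fderiv ℝ (F.momentum e s) p (V, 0) u := fun u => rfl
    obtain ⟨c, z, hcz⟩ := exists_polarMatrix_eq hdet β
    -- Evaluate at `V`: β(V) = 0 by antisymmetry and the fibre derivatives of p vanish on `V`, while
    -- p(V) = 1.
    have hc : c = 0 := by
      have h := hcz V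
      rw [hβ', sub_self, hV2, hV1] at h
      linarith
    refine ⟨(V, z), hV1, fun Z => ?_⟩
    have hsplit : ∀ (a : Model d) (b : EuclideanSpace ℝ (Fin d)),
        fderiv ℝ (F.momentum e s) p (a, b) = fderiv ℝ (F.momentum e s) p (a, 0) +
          fderiv ℝ (fun w => fderiv ℝ φ (direction s w)) p.2 b := by
      intro a b
      rw [hφ, ← F.fderiv_momentum_fibre he s hp, ← map_add]
      simp
    have hZ : Z = (Z.1, Z.2) := rfl
    rw [F.dOneForm_hilbertForm he s hp, hsplit V z, hZ, hsplit Z.1 Z.2]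
    simp only [add_apply, hV2]
    have h := hcz Z.1
    rw [hβ', hc, zero_mul] at h
    linarith
  have hR : IsReebAt (F.hilbertForm e s) p (reeb (F.hilbertForm e s) p) :=
    Classical.epsilon_spec hex
  -- The base part is unique: p takes the value 1 on it, and contracting `dA` with fibre vectors
  -- shows that every ∂p/∂wₖ vanishes on it. `V` satisfies the same equations.
  refine eq_of_polarMatrix hdet ?_ fun k => ?_
  · exact hR.1.trans hV1.symm
  · rw [hV2]
    have h := hR.2 (0, EuclideanSpace.single k 1)
    rw [F.dOneForm_hilbertForm he s hp, F.fderiv_momentum_fibre he s hp] at h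
    simpa using h

end FinslerMetric

end Finsler

end

/-! ### Measurability, and integration of the fibre bounds -/

noncomputable section

namespace Finsler

variable {d : ℕ}

/-- A function in `L²_loc(U)` is almost everywhere strongly measurable on `U`. -/
lemma MemL2Loc.aestronglyMeasurable {G : Type*} [NormedAddCommGroup G] {U : Set (Model d)}
    (hU : IsOpen U) {u : Model d → G} (h : MemL2Loc U u) :
    AEStronglyMeasurable u (volume.restrict U) := by
  have : LocallyCompactSpace U := hU.locallyCompactSpace
  have hcov : U = ⋃ n, ((↑) : U → Model d) '' compactCovering U n := by
    rw [← image_iUnion, iUnion_compactCovering, image_univ, Subtype.range_coe]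
  have key : AEStronglyMeasurable u
      (volume.restrict (⋃ n, ((↑) : U → Model d) '' compactCovering U n)) :=
    aestronglyMeasurable_iUnion_iff.2 fun n =>
      (h _ (Subtype.coe_image_subset _ _)
        ((isCompact_compactCovering U n).image continuous_subtype_val)).1
  rwa [← hcov] at key

variable {M : Type*} [TopologicalSpace M] [ChartedSpace (Model d) M]

lemma ChartPiece.image_subset_target (P : ChartPiece d M) :
    P.chart '' P.carrier ⊆ P.chart.target := by
  rintro _ ⟨x, hx, rfl⟩
  exact P.chart.map_source (P.subset_source hx)

lemma ChartPiece.measurableSet_image (P : ChartPiece d M) :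
    MeasurableSet (P.chart '' P.carrier) := by
  borelize M
  have hP : MeasurableSet P.carrier := P.measurable
  rw [P.chart.image_eq_target_inter_inv_preimage P.subset_source]
  have h1 : Measurable (fun y : P.chart.target => P.chart.symm y) :=
    (continuousOn_iff_continuous_domRestrict.1 P.chart.continuousOn_symm).measurable
  have h2 := MeasurableSet.subtype_image P.chart.open_target.measurableSet (h1 hP)
  convert h2 using 1
  ext y
  simp only [mem_inter_iff, mem_preimage, mem_image, Subtype.exists]
  constructor
  · rintro ⟨hy, h⟩
    exact ⟨y, hy, h, rfl⟩
  · rintro ⟨z, hz, h, rfl⟩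
    exact ⟨hz, h⟩

lemma MemH1Loc.aestronglyMeasurable_weakDifferential {f : M → ℝ} (hf : MemH1Loc d f)
    {e : OpenPartialHomeomorph M (Model d)} (he : e ∈ atlas (Model d) M) :
    AEStronglyMeasurable (covectorInChart (weakDifferential d f) e)
      (volume.restrict e.target) := by
  have h : IsWeakDifferential f (weakDifferential d f) := by
    have h1 : weakDifferential d f = hf.choose := by
      funext x
      rw [weakDifferential, dif_pos hf]
    rw [h1]
    exact hf.choose_spec
  exact (h e he).2.1.aestronglyMeasurable e.open_target

variable [IsManifold 𝓘(ℝ, Model d) ∞ M]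

namespace FinslerMetric

variable (F : FinslerMetric d M) {e : OpenPartialHomeomorph M (Model d)}

lemma continuousOn_polarMatrix_det (he : e ∈ atlas (Model d) M) (s : ℤˣ) :
    ContinuousOn (fun p : HCoord d => (polarMatrix (F.inChart e p.1) s p.2).det)
      (e.target ×ˢ univ) := by
  have hopen : IsOpen (e.target ×ˢ (univ : Set (EuclideanSpace ℝ (Fin d)))) :=
    e.open_target.prod isOpen_univ
  have h1 : ContDiffOn ℝ ∞ (F.momentum e s) (e.target ×ˢ univ) := fun p hp =>
    (F.contDiffAt_momentum he s hp.1).contDiffWithinAt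
  have h2 := h1.continuousOn_fderiv_of_isOpen hopen (by simp)
  refine continuous_id.matrix_det.comp_continuousOn
    (f := fun p : HCoord d => polarMatrix (F.inChart e p.1) s p.2) ?_
  refine continuousOn_pi.2 fun i => continuousOn_pi.2 fun j => ?_
  refine Fin.cases ?_ (fun k => ?_) j
  · exact h1.continuousOn.clm_apply continuousOn_const
  · refine ((h2.clm_apply (g := fun _ => ((0 : Model d), EuclideanSpace.single k (1 : ℝ)))
      continuousOn_const).clm_apply (g := fun _ => EuclideanSpace.single i (1 : ℝ))
      continuousOn_const).congr fun p hp => ?_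
    exact (congrArg (fun L : Model d →L[ℝ] ℝ => L (EuclideanSpace.single i 1))
      (F.fderiv_momentum_fibre he s hp.1 (EuclideanSpace.single k 1))).symm

lemma continuousOn_inChart_direction (he : e ∈ atlas (Model d) M) (s : ℤˣ) :
    ContinuousOn (fun p : HCoord d => F.inChart e p.1 (direction s p.2)) (e.target ×ˢ univ) := by
  refine (F.contDiffOn_inChart he).continuousOn.comp
    (f := fun p : HCoord d => (p.1, direction s p.2)) ?_ fun p hp =>
      ⟨hp.1, direction_ne_zero s p.2⟩
  have : Continuous (direction (d := d) s) := (contDiff_direction s (n := 0)).continuous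
  exact (by fun_prop : Continuous fun p : HCoord d => (p.1, direction s p.2)).continuousOn

/-- The integrand of the energy, up to a universal factor. -/
lemma ofReal_lieReeb_sq_mul_contactDensity (f : M → ℝ) (he : e ∈ atlas (Model d) M) (s : ℤˣ)
    {p : HCoord d} (hp : p.1 ∈ e.target) :
    ENNReal.ofReal (F.lieReeb f e s p ^ 2 * F.contactDensity e s p) =
      ENNReal.ofReal |wedgeConst d| *
        (ENNReal.ofReal |(polarMatrix (F.inChart e p.1) s p.2).det| *
          ENNReal.ofReal (dirEnergy (F.inChart e p.1)
            (covectorInChart (weakDifferential d f) e p.1) s p.2)) := by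
  rw [F.contactDensity_eq he s hp, ← ENNReal.ofReal_mul (abs_nonneg _),
    ← ENNReal.ofReal_mul (abs_nonneg _)]
  -- Where the Jacobian vanishes, the chosen Reeb value is not controlled, but the density is zero
  -- there. Nondegeneracy of the contact form is thus never needed.
  by_cases hdet : (polarMatrix (F.inChart e p.1) s p.2).det = 0
  · simp [hdet]
  · rw [lieReeb, F.reeb_fst he s hp hdet, map_smul, smul_eq_mul, dirEnergy, ← div_eq_inv_mul]
    congr 1
    ring

lemma aemeasurable_integrand {f : M → ℝ} (hf : MemH1Loc d f) (he : e ∈ atlas (Model d) M)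
    (s : ℤˣ) : AEMeasurable (fun p : HCoord d =>
      ENNReal.ofReal |(polarMatrix (F.inChart e p.1) s p.2).det| *
          ENNReal.ofReal (dirEnergy (F.inChart e p.1)
            (covectorInChart (weakDifferential d f) e p.1) s p.2))
      ((volume.restrict e.target).prod volume) := by
  have hprod : ((volume : Measure (Model d)).restrict e.target).prod
      (volume : Measure (EuclideanSpace ℝ (Fin d))) =
      (volume : Measure (HCoord d)).restrict (e.target ×ˢ univ) := by
    rw [Measure.volume_eq_prod, ← Measure.prod_restrict, Measure.restrict_univ]
  have hms : MeasurableSet (e.target ×ˢ (univ : Set (EuclideanSpace ℝ (Fin d)))) :=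
    (e.open_target.prod isOpen_univ).measurableSet
  have h1 : AEMeasurable (fun p : HCoord d => (polarMatrix (F.inChart e p.1) s p.2).det)
      ((volume.restrict e.target).prod volume) := by
    rw [hprod]
    exact ((F.continuousOn_polarMatrix_det he s).aestronglyMeasurable hms).aemeasurable
  have h2 : AEMeasurable (fun p : HCoord d => F.inChart e p.1 (direction s p.2))
      ((volume.restrict e.target).prod volume) := by
    rw [hprod]
    exact ((F.continuousOn_inChart_direction he s).aestronglyMeasurable hms).aemeasurable
  have h3 : AEStronglyMeasurable
      (fun p : HCoord d => covectorInChart (weakDifferential d f) e p.1)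
      ((volume.restrict e.target).prod (volume : Measure (EuclideanSpace ℝ (Fin d)))) :=
    (hf.aestronglyMeasurable_weakDifferential he).comp_fst
  have h4 : AEStronglyMeasurable (fun p : HCoord d => direction s p.2)
      ((volume.restrict e.target).prod volume) := by
    have : Continuous (direction (d := d) s) := (contDiff_direction s (n := 0)).continuous
    exact (this.comp continuous_snd).aestronglyMeasurable
  have h5 : AEMeasurable (fun p : HCoord d =>
      covectorInChart (weakDifferential d f) e p.1 (direction s p.2))
      ((volume.restrict e.target).prod volume) :=
    (Continuous.comp_aestronglyMeasurable₂ (g := fun (L : Model d →L[ℝ] ℝ) v => L v)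
      isBoundedBilinearMap_apply.continuous h3 h4).aemeasurable
  exact (h1.abs.ennreal_ofReal).mul (((h5.div h2).pow_const 2).ennreal_ofReal)

/-- The energy over a piece is the integral of the fibre energies. -/
theorem energyOn_eq {f : M → ℝ} (hf : MemH1Loc d f) (P : ChartPiece d M) :
    F.energyOn f P = ENNReal.ofReal |wedgeConst d| * ∫⁻ y in P.chart '' P.carrier,
      fibreEnergy (F.inChart P.chart y) (covectorInChart (weakDifferential d f) P.chart y) := by
  set S := P.chart '' P.carrier with hS
  have hSt : S ⊆ P.chart.target := P.image_subset_target
  have hSm : MeasurableSet S := P.measurableSet_image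
  have hae : ∀ s : ℤˣ, AEMeasurable (fun p : HCoord d =>
      ENNReal.ofReal |(polarMatrix (F.inChart P.chart p.1) s p.2).det| *
          ENNReal.ofReal (dirEnergy (F.inChart P.chart p.1)
            (covectorInChart (weakDifferential d f) P.chart p.1) s p.2))
      ((volume.restrict S).prod volume) := fun s =>
    (F.aemeasurable_integrand hf P.chart_mem s).mono_measure
      (Measure.prod_mono (Measure.restrict_mono hSt le_rfl) le_rfl)
  unfold fibreEnergy
  rw [lintegral_finsetSum' _ fun s _ => (hae s).lintegral_prod_right', Finset.mul_sum, energyOn]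
  refine Finset.sum_congr rfl fun s _ => ?_
  rw [← lintegral_prod _ (hae s), ← lintegral_const_mul' _ _ ENNReal.ofReal_ne_top]
  have hprod : ((volume : Measure (Model d)).restrict S).prod
      (volume : Measure (EuclideanSpace ℝ (Fin d))) =
      (volume : Measure (HCoord d)).restrict (S ×ˢ univ) := by
    rw [Measure.volume_eq_prod, ← Measure.prod_restrict, Measure.restrict_univ]
  rw [hprod]
  exact setLIntegral_congr_fun (hSm.prod MeasurableSet.univ) fun p hp =>
    F.ofReal_lieReeb_sq_mul_contactDensity f P.chart_mem s (hSt hp.1)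

/-- Both energies involve the same weak differential and the same universal factors, so the
pointwise fibre bound passes through the integral over each piece, the finite sums and the supremum.
The disjunction allows the roles of the two metrics to be exchanged. -/
theorem energy_le {F F₀ : FinslerMetric d M} {C C₁ C₂ : ℝ} (hC : 0 < C)
    (h : F.BiLipschitz F₀ C ∨ F₀.BiLipschitz F C)
    (h₁ : F.IsQuasireversibilityConstant C₁) (h₂ : F₀.IsQuasireversibilityConstant C₂)
    {f : M → ℝ} (hf : MemH1Loc d f) :
    F.energy f ≤ ENNReal.ofReal (compConst d C C₁ C₂) * F₀.energy f := by
  have hle : ∀ {e : OpenPartialHomeomorph M (Model d)}, e ∈ atlas (Model d) M →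
      ∀ {y : Model d}, y ∈ e.target → ∀ v,
      F.inChart e y v ≤ C * F₀.inChart e y v ∧ F₀.inChart e y v ≤ C * F.inChart e y v := by
    intro e he y hy v
    rcases h with h | h
    · exact h.inChart_le hC he hy v
    · exact (h.inChart_le hC he hy v).symm
  have hP : ∀ P : ChartPiece d M, F.energyOn f P ≤
      ENNReal.ofReal (compConst d C C₁ C₂) * F₀.energyOn f P := by
    intro P
    rw [F.energyOn_eq hf, F₀.energyOn_eq hf, mul_left_comm]
    refine mul_le_mul' le_rfl ?_
    rw [← lintegral_const_mul' _ _ ENNReal.ofReal_ne_top]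
    refine setLIntegral_mono' P.measurableSet_image fun y hy => ?_
    have hy' := P.image_subset_target hy
    exact fibreEnergy_le_compConst_mul (F.isMinkowskiNorm_inChart P.chart_mem hy')
      (F₀.isMinkowskiNorm_inChart P.chart_mem hy') hC (F.inChart_neg_le P.chart_mem hy' h₁)
      (F₀.inChart_neg_le P.chart_mem hy' h₂) (fun v => (hle P.chart_mem hy' v).1)
      (fun v => (hle P.chart_mem hy' v).2) _
  rw [energy, energy, mul_left_comm]
  refine mul_le_mul' le_rfl ?_
  refine iSup₂_le fun S hS => ?_
  refine (Finset.sum_le_sum fun P _ => hP P).trans ?_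
  rw [← Finset.mul_sum]
  gcongr
  exact le_iSup₂ (f := fun (S : Finset (ChartPiece d M))
    (_ : (S : Set (ChartPiece d M)).PairwiseDisjoint ChartPiece.carrier) =>
      ∑ P ∈ S, F₀.energyOn f P) S hS

end FinslerMetric

end Finsler

end

/-! ### The constant `K` and the conclusion -/

theorem theorem3p1 (d : ℕ) (C C₁ C₂ : ℝ) (hC : 1 < C) :
    ∃ K : ℝ, 1 ≤ K ∧
      ∀ (M : Type*) [TopologicalSpace M] [T2Space M] [SecondCountableTopology M]
        [ChartedSpace (Finsler.Model d) M] [IsManifold 𝓘(ℝ, Finsler.Model d) ∞ M]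
        (F F₀ : Finsler.FinslerMetric d M),
        F.BiLipschitz F₀ C →
        F.IsQuasireversibilityConstant C₁ →
        F₀.IsQuasireversibilityConstant C₂ →
        ∀ f : M → ℝ, Finsler.MemH1Loc d f →
          ENNReal.ofReal (C ^ (-K)) * F₀.energy f ≤ F.energy f ∧
            F.energy f ≤ ENNReal.ofReal (C ^ K) * F₀.energy f := by
  have hC0 : 0 < C := one_pos.trans hC
  -- One constant for both inequalities. The entry 1 makes it positive, so that its logarithm in
  -- base `C` satisfies C ^ log_C(A) = A.
  set A := max (Finsler.compConst d C C₁ C₂) (max (Finsler.compConst d C C₂ C₁) 1) with hA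
  have hA0 : 0 < A := one_pos.trans_le ((le_max_right _ _).trans (le_max_right _ _))
  refine ⟨max 1 (Real.logb C A), le_max_left _ _, ?_⟩
  intro M _ _ _ _ _ F F₀ h h₁ h₂ f hf
  set K := max 1 (Real.logb C A) with hK
  have hAK : A ≤ C ^ K := by
    calc A = C ^ Real.logb C A := (Real.rpow_logb hC0 hC.ne' hA0).symm
      _ ≤ C ^ K := Real.rpow_le_rpow_of_exponent_le hC.le (le_max_right _ _)
  have hup := Finsler.FinslerMetric.energy_le hC0 (Or.inl h) h₁ h₂ hf
  have hlow := Finsler.FinslerMetric.energy_le hC0 (Or.inr h) h₂ h₁ hf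
  constructor
  · calc ENNReal.ofReal (C ^ (-K)) * F₀.energy f
        ≤ ENNReal.ofReal (C ^ (-K)) * (ENNReal.ofReal (C ^ K) * F.energy f) := by
          gcongr
          refine hlow.trans ?_
          gcongr
          exact ((le_max_left _ _).trans (le_max_right _ _)).trans hAK
      _ = F.energy f := by
          rw [← mul_assoc, ← ENNReal.ofReal_mul (Real.rpow_nonneg hC0.le _),
            ← Real.rpow_add hC0, neg_add_cancel, Real.rpow_zero, ENNReal.ofReal_one, one_mul]
  · refine hup.trans ?_
    gcongr
    exact (le_max_left _ _).trans hAK
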